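/- **Definitions.** A Turing machine is a deterministic multitape machine with finitely many tapes, states and tape symbols, with binary input and output on one designated tape. It is *reversible* if every configuration has at most one predecessor and a configuration in the start state has none (the halting state has no successor). $R(u)=v$ means that $R$, started on input $u$ with all other tapes blank, halts with $v$ on the input/output tape and all other tapes blank (heads in standard position). Let $\langle\cdot,\cdot\rangle$ be the standard computable bijective pairing of binary strings, $|x|$ the length of $x$, and $\epsilon$ the empty string. For a reversible machine $R$ put $$E_R(x,y)=\min\{|p|+|q| : R(\langle x,p\rangle)=\langle y,q\rangle\},$$ and for $t:\mathbb N\to\mathbb N$ let $$E_R^t(x,y)=\min\{|p|+|q| : R(\langle x,p\rangle)=\langle y,q\rangle \text{ in at most } t(|x|) \text{ steps}\},$$ with $\min\emptyset=\infty$. A reversible machine $UR$ is *universal* if for every reversible machine $R$ there is a constant $c_R$ with $E_{UR}(x,y)\le E_R(x,y)+c_R$ for all $x,y$. An *r.e. sequence* is the characteristic sequence $\chi=\chi_1\chi_2\dots$ of a recursively enumerable set $A\subseteq\mathbb N$ ($\chi_i=1$ if $i\in A$, and $\chi_i=0$ otherwise). **Theorem (extreme trade-off).** Universal reversible Turing machines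 exist. Fix any such machine $UR$ as reference machine and write $E^t=E^t_{UR}$. Then there are an r.e. sequence $\chi$ and a nonrecursively large time bound $T:\mathbb N\to\mathbb N$ (for every total recursive $t$ one has $t(n)<T(n)$ for all sufficiently large $n$) such that for every total recursive time bound $t$ there is a constant $c_t>0$ such that for every nonempty initial segment $x=\chi_1\dots\chi_n$ of $\chi$ the number $E^T(x,\epsilon)$ is finite and $$E^t(x,\epsilon) > c_t\,2^{E^{T}(x,\epsilon)/2}.$$ -/

import Mathlib

/-! ## Binary strings, natural numbers and pairing -/

/-- The number of a binary string in the length-lexicographic order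
`ε, 0, 1, 00, 01, 10, 11, 000, …`, which are numbered `0, 1, 2, …`. -/
def strNum (s : List Bool) : ℕ :=
  s.foldl (fun n b => 2 * n + (if b then 2 else 1)) 0

/-- The binary string with a given number: the inverse of `strNum`. -/
def numStr : ℕ → List Bool
  | 0 => []
  | n + 1 => numStr (n / 2) ++ [decide (n % 2 = 1)]
decreasing_by omega

theorem strNum_append (s : List Bool) (b : Bool) :
    strNum (s ++ [b]) = 2 * strNum s + (if b then 2 else 1) := by
  simp [strNum]

theorem strNum_numStr (n : ℕ) : strNum (numStr n) = n := by
  induction n using Nat.strong_induction_on with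
  | _ n ih =>
    cases n with
    | zero => simp [numStr, strNum]
    | succ n =>
      rw [numStr, strNum_append, ih (n / 2) (by omega)]
      simp only [decide_eq_true_eq]
      split <;> omega

theorem numStr_strNum (s : List Bool) : numStr (strNum s) = s := by
  induction s using List.reverseRecOn with
  | nil => simp [numStr, strNum]
  | append_singleton s b ih =>
    rw [strNum_append]
    cases b
    · have h1 : 2 * strNum s / 2 = strNum s := by omega
      have h2 : ¬ (2 * strNum s) % 2 = 1 := by omega
      simp [numStr, ih]
    · have h1 : (2 * strNum s + 1) / 2 = strNum s := by omega
      have h2 : (2 * strNum s + 1) % 2 = 1 := by omega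
      simp [numStr, ih, h1, h2]

/-- The identification of `{0,1}*` with `ℕ`. -/
def strEquiv : List Bool ≃ ℕ where
  toFun := strNum
  invFun := numStr
  left_inv := numStr_strNum
  right_inv := strNum_numStr

/-- The pairing `⟨x, y⟩` of binary strings: the computable bijection `Nat.pair : ℕ × ℕ → ℕ`
carried over to strings. -/
def strPair (x y : List Bool) : List Bool :=
  strEquiv.symm (Nat.pair (strEquiv x) (strEquiv y))

/-! ## Multitape Turing machines and reversibility -/

/-- A tape symbol: the blank `none`, a bit, or one of the extra work symbols in `S`. -/
abbrev TapeSymbol (S : Type) : Type := Option (Bool ⊕ S)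

/-- A deterministic multitape Turing machine with binary input and output. In one step it reads
the scanned symbol of every tape and either stops (`none`) or changes its state, overwrites
every scanned symbol, and moves every head left, right, or not at all (`none`). -/
structure TuringMachine where
  /-- the tapes -/
  K : Type
  [finK : Finite K]
  [decK : DecidableEq K]
  /-- the tape that carries the input and the output -/
  io : K
  /-- the work symbols other than the blank and the bits -/
  S : Type
  [finS : Finite S]
  /-- the states -/
  Q : Type
  [finQ : Finite Q]
  start : Q
  halt : Q
  δ : Q → (K → TapeSymbol S) → Option (Q × (K → TapeSymbol S × Option Turing.Dir))
  δ_halt : ∀ s, δ halt s = none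

namespace TuringMachine

attribute [instance] finK decK finS finQ

/-- A configuration: a state, and every tape together with the position of its head
(a `Turing.Tape` is two-way infinite, all but finitely many cells are blank). -/
structure Cfg (M : TuringMachine) where
  state : M.Q
  tape : M.K → Turing.Tape (TapeSymbol M.S)

/-- Move a head in a direction, `none` meaning that it stays. -/
def moveHead {Γ : Type} [Inhabited Γ] : Option Turing.Dir → Turing.Tape Γ → Turing.Tape Γ
  | none, T => T
  | some d, T => T.move d

/-- One step of computation; `none` if the machine has stopped. -/
def step (M : TuringMachine) (c : M.Cfg) : Option M.Cfg :=
  (M.δ c.state (fun k => (c.tape k).head)).map fun a =>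
    { state := a.1
      tape := fun k => moveHead (a.2 k).2 ((c.tape k).write (a.2 k).1) }

/-- Exactly `n` steps of computation; `none` if the machine stops earlier. -/
def stepN (M : TuringMachine) : ℕ → M.Cfg → Option M.Cfg
  | 0, c => some c
  | n + 1, c => (M.step c).bind (M.stepN n)

/-- The configuration in state `q` in which the input/output tape holds exactly the string `u`,
with the head on its first bit, and all other tapes are blank. -/
def stdCfg (M : TuringMachine) (q : M.Q) (u : List Bool) : M.Cfg where
  state := q
  tape k := if k = M.io then Turing.Tape.mk₁ (u.map fun b => some (Sum.inl b)) else default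

/-- `M` started on input `u` halts with output `v` after exactly `n` steps. No other information
than `v` is left in the final configuration. -/
def ComputesIn (M : TuringMachine) (n : ℕ) (u v : List Bool) : Prop :=
  M.stepN n (M.stdCfg M.start u) = some (M.stdCfg M.halt v)

/-- `M` is reversible: every configuration has at most one predecessor, and a configuration in
the start state has none (just as a configuration in the halting state has no successor), so a
computation can be traced back from its result to its beginning. -/
def IsReversible (M : TuringMachine) : Prop :=
  (∀ c c' d : M.Cfg, M.step c = some d → M.step c' = some d → c = c') ∧
  ∀ c d : M.Cfg, M.step c = some d → d.state ≠ M.start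

/-! ## Irreversibility cost -/

/-- The irreversibility cost `E_R(x, y) = min {|p| + |q| : R(⟨x, p⟩) = ⟨y, q⟩}`
(`⊤` if there are no such `p` and `q`). -/
noncomputable def cost (R : TuringMachine) (x y : List Bool) : ℕ∞ :=
  ⨅ (p : List Bool) (q : List Bool) (_ : ∃ n, R.ComputesIn n (strPair x p) (strPair y q)),
    ((p.length + q.length : ℕ) : ℕ∞)

/-- The irreversibility cost in time `t`,
`E_R^t(x, y) = min {|p| + |q| : R(⟨x, p⟩) = ⟨y, q⟩ in at most t(|x|) steps}`
(`⊤` if there are no such `p` and `q`). -/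
noncomputable def timedCost (R : TuringMachine) (t : ℕ → ℕ) (x y : List Bool) : ℕ∞ :=
  ⨅ (p : List Bool) (q : List Bool)
    (_ : ∃ n ≤ t x.length, R.ComputesIn n (strPair x p) (strPair y q)),
    ((p.length + q.length : ℕ) : ℕ∞)

/-- `U` is a universal reversible machine: its cost function is, up to an additive constant,
below that of every reversible machine. -/
def IsUniversalReversible (U : TuringMachine) : Prop :=
  U.IsReversible ∧
  ∀ R : TuringMachine, R.IsReversible →
    ∃ c : ℕ, ∀ x y : List Bool, U.cost x y ≤ R.cost x y + (c : ℕ∞)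

end TuringMachine

/-! ## Recursively enumerable sequences -/

/-- `χ = χ₁χ₂…` is the characteristic sequence of a recursively enumerable set (the value
`χ 0` is not part of the sequence). -/
def IsRESequence (χ : ℕ → Bool) : Prop :=
  ∃ A : Set ℕ, REPred (fun i => i ∈ A) ∧ ∀ i, 1 ≤ i → (χ i = true ↔ i ∈ A)

/-- The initial segment `χ₁…χₙ`. -/
def initialSegment (χ : ℕ → Bool) (n : ℕ) : List Bool :=
  (List.range n).map fun i => χ (i + 1)

/-! ## Reversible machines as local partial injections -/

/-! Lower bound. If `UR` maps ⟨x, p⟩ to ⟨ε, q⟩ within t(|x|) steps and |p| ≤ |x|, then, inputs being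
determined by outputs, a bounded search recovers x from |x| and q (`exists_primrec_decoder`). The
sequence χ diagonalizes against such decoders. Disjoint blocks of 2 ^ k positions are assigned to
the pairs (e, k), and on block (e, k) χ spells the least word missing from the list that program e
outputs on (e, k), whenever that list exists and has fewer than 2 ^ 2 ^ k entries; this is r.e.
because the word can be waited for (`exists_isRESequence_avoiding`). For recursive t the decoder's
outputs on all small pairs (n, q) form such a list, so a q much shorter than n would put a block of
χ into a list that χ avoids. Hence the cost in time t is at least linear in n
(`exists_linear_lower_bound`).

Upper bound. An initial segment of an r.e. sequence is determined by its length n and its number of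
ones: enumerate until that many ones have appeared. The number of the pair is below (n + 1) ^ 2, so
some reversible machine erases x with p = ε and |q| ≤ 2 log (n + 1) (`exists_eraser`). Universality
adds a constant, and T is chosen above the running times and above all recursive functions. Thus 2 ^
(E^T / 2) is at most a constant times n, while E^t exceeds a constant times n. Cost zero is possible
for only one x, and the first bit of χ is chosen to exclude it.

Machines. Both the eraser and the universal machine come from `exists_reversible_of_partrec`,
Bennett's construction: given programs for f and for its inverse g, compute f with a history, copy
the result, uncompute, and then do the same backwards with g to remove the input. The universal
machine keeps its program in the output, so that the inverse can read it too. That every reversible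
machine is covered follows because its computations are primitive recursively checkable
(`exists_primrec_computesIn`), so the function and its inverse are partial recursive by search. -/

/-- The opposite move of a head. -/
def oppMove : Option Turing.Dir → Option Turing.Dir
  | none => none
  | some Turing.Dir.left => some Turing.Dir.right
  | some Turing.Dir.right => some Turing.Dir.left

open TuringMachine (moveHead)

theorem moveHead_oppMove {Γ : Type} [Inhabited Γ] (d : Option Turing.Dir) (T : Turing.Tape Γ) :
    moveHead (oppMove d) (moveHead d T) = T := by
  rcases d with _ | _ | _ <;> simp [moveHead, oppMove]

theorem moveHead_injective {Γ : Type} [Inhabited Γ] (d : Option Turing.Dir) :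
    Function.Injective (moveHead (Γ := Γ) d) :=
  Function.LeftInverse.injective (moveHead_oppMove d)

theorem Turing.Tape.write_write {Γ : Type} [Inhabited Γ] (a b : Γ) (T : Turing.Tape Γ) :
    (T.write a).write b = T.write b := rfl

theorem Turing.Tape.head_write {Γ : Type} [Inhabited Γ] (a : Γ) (T : Turing.Tape Γ) :
    (T.write a).head = a := rfl

/-- A reversible machine: the rules `W q a q' b` (in state `q` reading `a`, go to state `q'` and
write `b`) form a partial injection, and the head movements `d q'` depend on the new state. -/
structure RevMachine (K Γ : Type) where
  Q : Type
  [finQ : Finite Q]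
  start : Q
  halt : Q
  d : Q → K → Option Turing.Dir
  W : Q → (K → Γ) → Q → (K → Γ) → Prop
  fwd : ∀ {q a q₁ b₁ q₂ b₂}, W q a q₁ b₁ → W q a q₂ b₂ → q₁ = q₂ ∧ b₁ = b₂
  bwd : ∀ {q₁ a₁ q₂ a₂ q b}, W q₁ a₁ q b → W q₂ a₂ q b → q₁ = q₂ ∧ a₁ = a₂
  start_in : ∀ {q a b}, ¬ W q a start b
  halt_out : ∀ {a q b}, ¬ W halt a q b
  d_start : ∀ k, d start k = none
  d_halt : ∀ k, d halt k = none

namespace RevMachine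

open Relation

attribute [instance] finQ

section

variable {K Γ : Type} [Inhabited Γ]

/-- One step of a reversible machine, as a relation between configurations. -/
def Step (M : RevMachine K Γ) (c c' : M.Q × (K → Turing.Tape Γ)) : Prop :=
  ∃ b, M.W c.1 (fun k => (c.2 k).head) c'.1 b ∧
    c'.2 = fun k => moveHead (M.d c'.1 k) ((c.2 k).write (b k))

/-- `M` started on the tapes `T` halts with the tapes `T'`. -/
def Runs (M : RevMachine K Γ) (T T' : K → Turing.Tape Γ) : Prop :=
  ReflTransGen M.Step (M.start, T) (M.halt, T')

/-- The machine that runs backwards. -/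
def inv (M : RevMachine K Γ) : RevMachine K Γ where
  Q := M.Q
  start := M.halt
  halt := M.start
  d q k := oppMove (M.d q k)
  W q a q' b := M.W q' b q a
  fwd h h' := M.bwd h h'
  bwd h h' := M.fwd h h'
  start_in := M.halt_out
  halt_out := M.start_in
  d_start k := by rw [M.d_halt]; rfl
  d_halt k := by rw [M.d_start]; rfl

/-- The configuration of the backward machine that corresponds to a configuration. -/
def invCfg (M : RevMachine K Γ) (c : M.Q × (K → Turing.Tape Γ)) : M.inv.Q × (K → Turing.Tape Γ) :=
  (c.1, fun k => moveHead (oppMove (M.d c.1 k)) (c.2 k))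

/-- The moves of a step depend only on the state entered, so they can be undone before anything is
read. The heads then scan the symbols just written, and the reversed rule puts the old symbols back.
-/
theorem Step.inv {M : RevMachine K Γ} {c c' : M.Q × (K → Turing.Tape Γ)} (h : M.Step c c') :
    M.inv.Step (M.invCfg c') (M.invCfg c) := by
  obtain ⟨b, hW, hT⟩ := h
  refine ⟨fun k => (c.2 k).head, ?_, ?_⟩
  · simpa [RevMachine.inv, invCfg, hT, moveHead_oppMove, Turing.Tape.head_write] using hW
  · funext k
    simp [RevMachine.inv, invCfg, hT, moveHead_oppMove, Turing.Tape.write_write,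
      Turing.Tape.write_self]

/-- No head moves on entering the start or the halting state, so `invCfg` changes nothing at the two
ends of a run. -/
theorem Runs.inv {M : RevMachine K Γ} {T T' : K → Turing.Tape Γ} (h : M.Runs T T') :
    M.inv.Runs T' T := by
  have key : ∀ {c c'}, ReflTransGen M.Step c c' →
      ReflTransGen M.inv.Step (M.invCfg c') (M.invCfg c) := by
    intro c c' h
    induction h with
    | refl => exact .refl
    | tail _ h ih => exact .head h.inv ih
  have := key h
  simp only [invCfg, M.d_start, M.d_halt, oppMove, moveHead] at this
  exact this

/-- Rules of the sequential composition. -/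
inductive SeqRule (M N : RevMachine K Γ) :
    M.Q ⊕ N.Q → (K → Γ) → M.Q ⊕ N.Q → (K → Γ) → Prop
  | left {q a q' b} : M.W q a q' b → SeqRule M N (.inl q) a (.inl q') b
  | link {a} : SeqRule M N (.inl M.halt) a (.inr N.start) a
  | right {q a q' b} : N.W q a q' b → SeqRule M N (.inr q) a (.inr q') b

/-- Sequential composition. -/
def seq (M N : RevMachine K Γ) : RevMachine K Γ where
  Q := M.Q ⊕ N.Q
  start := .inl M.start
  halt := .inr N.halt
  d := Sum.elim M.d N.d
  W := SeqRule M N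
  fwd h h' := by
    cases h with
    | left h => cases h' with
      | left h' => simpa using M.fwd h h'
      | link => exact absurd h M.halt_out
    | link => cases h' with
      | left h' => exact absurd h' M.halt_out
      | link => simp
    | right h => cases h' with
      | right h' => simpa using N.fwd h h'
  bwd h h' := by
    cases h with
    | left h => cases h' with
      | left h' => simpa using M.bwd h h'
    | link => cases h' with
      | link => simp
      | right h' => exact absurd h' N.start_in
    | right h => cases h' with
      | link => exact absurd h N.start_in
      | right h' => simpa using N.bwd h h'
  start_in h := by cases h with | left h => exact M.start_in h
  halt_out h := by cases h with | right h => exact N.halt_out h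
  d_start := M.d_start
  d_halt := N.d_halt

theorem Runs.seq {M N : RevMachine K Γ} {T T' T'' : K → Turing.Tape Γ} (h : M.Runs T T')
    (h' : N.Runs T' T'') : (M.seq N).Runs T T'' := by
  have h1 : ReflTransGen (M.seq N).Step (.inl M.start, T) (.inl M.halt, T') :=
    ReflTransGen.lift (p := (M.seq N).Step)
      (fun c : M.Q × (K → Turing.Tape Γ) => ((.inl c.1, c.2) : (M.seq N).Q × _))
      (fun c c' ⟨b, hW, hT⟩ => ⟨b, SeqRule.left hW, hT⟩) _ _ h
  have h2 : ReflTransGen (M.seq N).Step (.inr N.start, T') (.inr N.halt, T'') :=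
    ReflTransGen.lift (p := (M.seq N).Step)
      (fun c : N.Q × (K → Turing.Tape Γ) => ((.inr c.1, c.2) : (M.seq N).Q × _))
      (fun c c' ⟨b, hW, hT⟩ => ⟨b, SeqRule.right hW, hT⟩) _ _ h'
  have h3 : (M.seq N).Step (.inl M.halt, T') (.inr N.start, T') := by
    refine ⟨fun k => (T' k).head, SeqRule.link, ?_⟩
    funext k
    simp [RevMachine.seq, N.d_start, moveHead, Turing.Tape.write_self]
  exact (h1.tail h3).trans h2

open Classical in
/-- The machine `M` working on the tapes in the range of `ι`. -/
noncomputable def lift {K₂ : Type} (ι : K₂ ↪ K) (M : RevMachine K₂ Γ) : RevMachine K Γ where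
  Q := M.Q
  start := M.start
  halt := M.halt
  d q := Function.extend ι (M.d q) fun _ => none
  W q a q' b := M.W q (a ∘ ι) q' (b ∘ ι) ∧ ∀ k, k ∉ Set.range ι → a k = b k
  fwd {q a q₁ b₁ q₂ b₂} h h' := by
    obtain ⟨e, e'⟩ := M.fwd h.1 h'.1
    refine ⟨e, funext fun k => ?_⟩
    by_cases hk : k ∈ Set.range ι
    · obtain ⟨j, rfl⟩ := hk
      exact congrFun e' j
    · rw [← h.2 k hk, ← h'.2 k hk]
  bwd {q a q₁ b₁ q₂ b₂} h h' := by
    obtain ⟨e, e'⟩ := M.bwd h.1 h'.1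
    refine ⟨e, funext fun k => ?_⟩
    by_cases hk : k ∈ Set.range ι
    · obtain ⟨j, rfl⟩ := hk
      exact congrFun e' j
    · rw [h.2 k hk, h'.2 k hk]
  start_in h := M.start_in h.1
  halt_out h := M.halt_out h.1
  d_start k := by
    by_cases hk : k ∈ Set.range ι
    · obtain ⟨j, rfl⟩ := hk
      rw [ι.injective.extend_apply, M.d_start]
    · rw [Function.extend_apply' _ _ _ hk]
  d_halt k := by
    by_cases hk : k ∈ Set.range ι
    · obtain ⟨j, rfl⟩ := hk
      rw [ι.injective.extend_apply, M.d_halt]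
    · rw [Function.extend_apply' _ _ _ hk]

theorem Runs.lift {K₂ : Type} (ι : K₂ ↪ K) {M : RevMachine K₂ Γ} {T T' : K → Turing.Tape Γ}
    (h : M.Runs (T ∘ ι) (T' ∘ ι)) (hT : ∀ k, k ∉ Set.range ι → T k = T' k) :
    (M.lift ι).Runs T T' := by
  have key := ReflTransGen.lift (r := M.Step) (p := (M.lift ι).Step)
    (fun c : M.Q × (K₂ → Turing.Tape Γ) =>
      ((c.1, Function.extend ι c.2 T) : (M.lift ι).Q × (K → Turing.Tape Γ))) (by
      rintro ⟨q, U⟩ ⟨q', U'⟩ ⟨b, hW, hU⟩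
      simp only at hU hW
      subst hU
      refine ⟨Function.extend ι b fun k => (T k).head, ⟨?_, ?_⟩, ?_⟩
      · convert hW using 1
        · funext j
          simp [ι.injective.extend_apply]
        · funext j
          simp [ι.injective.extend_apply]
      · intro k hk
        simp only [Set.mem_range] at hk
        simp [Function.extend_apply' _ _ _ hk]
      · funext k
        by_cases hk : k ∈ Set.range ι
        · obtain ⟨j, rfl⟩ := hk
          simp [RevMachine.lift, ι.injective.extend_apply]
        · simp only [Set.mem_range] at hk
          simp [RevMachine.lift, Function.extend_apply' _ _ _ hk, moveHead,
            Turing.Tape.write_self]) _ _ h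
  have e : ∀ U : K → Turing.Tape Γ, (∀ k, k ∉ Set.range ι → T k = U k) →
      Function.extend ι (U ∘ ι) T = U := by
    intro U hU
    funext k
    by_cases hk : k ∈ Set.range ι
    · obtain ⟨j, rfl⟩ := hk
      simp [ι.injective.extend_apply]
    · rw [Function.extend_apply' _ _ _ hk, hU k hk]
  simp only [Function.onFun, e T fun _ _ => rfl, e T' hT] at key
  exact key

end

/-! ### Conversion to Turing machines -/

section

variable {K S : Type} [Finite K] [DecidableEq K] [Finite S]

open Classical in
/-- A reversible machine as a Turing machine with input/output tape `io`. -/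
noncomputable def toTM (M : RevMachine K (TapeSymbol S)) (io : K) : TuringMachine where
  K := K
  io := io
  S := S
  Q := M.Q
  start := M.start
  halt := M.halt
  δ q a := if h : ∃ p : M.Q × (K → TapeSymbol S), M.W q a p.1 p.2 then
    some (h.choose.1, fun k => (h.choose.2 k, M.d h.choose.1 k)) else none
  δ_halt a := by
    rw [dif_neg]
    rintro ⟨p, hp⟩
    exact M.halt_out hp

open Classical in
theorem toTM_step (M : RevMachine K (TapeSymbol S)) (io : K) (c c' : (M.toTM io).Cfg) :
    (M.toTM io).step c = some c' ↔ M.Step (c.state, c.tape) (c'.state, c'.tape) := by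
  obtain ⟨q, T⟩ := c
  obtain ⟨q', T'⟩ := c'
  simp only [TuringMachine.step, Option.map_eq_some_iff, TuringMachine.Cfg.mk.injEq, Step]
  constructor
  · rintro ⟨x, hx, rfl, rfl⟩
    change (if h : ∃ p : M.Q × (K → TapeSymbol S), M.W q (fun k => (T k).head) p.1 p.2 then
      some (h.choose.1, fun k => (h.choose.2 k, M.d h.choose.1 k)) else none) = some x at hx
    split_ifs at hx with h
    obtain rfl := Option.some.inj hx
    exact ⟨_, h.choose_spec, rfl⟩
  · rintro ⟨b, hW, rfl⟩
    have h : ∃ p : M.Q × (K → TapeSymbol S), M.W q (fun k => (T k).head) p.1 p.2 := ⟨(q', b), hW⟩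
    obtain ⟨e, e'⟩ := M.fwd h.choose_spec hW
    refine ⟨(q', fun k => (b k, M.d q' k)), ?_, rfl, rfl⟩
    change (if h : ∃ p : M.Q × (K → TapeSymbol S), M.W q (fun k => (T k).head) p.1 p.2 then
      some (h.choose.1, fun k => (h.choose.2 k, M.d h.choose.1 k)) else none) = _
    rw [dif_pos h, e, e']
    rfl

/-- Undoing the moves of the common new state gives equal written tapes. Hence the written symbols
agree, `bwd` gives the old state and the old symbols, and writing these back gives the old tapes. -/
theorem toTM_isReversible (M : RevMachine K (TapeSymbol S)) (io : K) :
    (M.toTM io).IsReversible := by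
  refine ⟨?_, ?_⟩
  · rintro ⟨q, T⟩ ⟨q', T'⟩ ⟨q'', T''⟩ h h'
    rw [toTM_step] at h h'
    obtain ⟨b, hW, hT⟩ := h
    obtain ⟨b', hW', hT'⟩ := h'
    have e : ∀ k, (T k).write (b k) = (T' k).write (b' k) := fun k =>
      moveHead_injective _ ((congrFun hT k).symm.trans (congrFun hT' k))
    have eb : b = b' := funext fun k => congrArg Turing.Tape.head (e k)
    subst eb
    obtain ⟨rfl, e'⟩ := M.bwd hW hW'
    congr 1
    funext k
    have := congrArg (Turing.Tape.write (T k).head) (e k)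
    change (T k).write (T k).head = (T' k).write (T k).head at this
    rw [Turing.Tape.write_self, show (T k).head = (T' k).head from congrFun e' k,
      Turing.Tape.write_self] at this
    exact this
  · rintro c d h e
    rw [toTM_step] at h
    obtain ⟨b, hW, -⟩ := h
    simp only [e] at hW
    exact M.start_in hW

theorem Runs.computesIn {M : RevMachine K (TapeSymbol S)} {io : K} {u v : List Bool}
    (h : M.Runs ((M.toTM io).stdCfg (M.toTM io).start u).tape
      ((M.toTM io).stdCfg (M.toTM io).halt v).tape) :
    ∃ n, (M.toTM io).ComputesIn n u v := by
  have key : ∀ c c' : M.Q × (K → Turing.Tape (TapeSymbol S)), ReflTransGen M.Step c c' →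
      ∃ n, (M.toTM io).stepN n ⟨c.1, c.2⟩ = some ⟨c'.1, c'.2⟩ := by
    intro c c' h
    induction h using ReflTransGen.head_induction_on with
    | refl => exact ⟨0, rfl⟩
    | @head c d h _ ih =>
      obtain ⟨n, hn⟩ := ih
      have := (toTM_step M io ⟨c.1, c.2⟩ ⟨d.1, d.2⟩).2 h
      exact ⟨n + 1, by rw [TuringMachine.stepN, this]; exact hn⟩
  exact key _ _ h

end

end RevMachine

/-! ## Two-tape reversible machines for copying and for changing the encoding -/

section

open Turing (Tape ListBlank)
open TuringMachine (moveHead)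
open Relation

theorem ListBlank_mk_default {Γ : Type} [Inhabited Γ] :
    ListBlank.mk [(default : Γ)] = ListBlank.mk [] :=
  ListBlank.ext fun i => by rcases i with _ | i <;> simp [ListBlank.nth_mk, List.getI]

theorem mk₂_head {Γ : Type} [Inhabited Γ] (l r : List Γ) : (Tape.mk₂ l r).head = r.headI := rfl

theorem mk₂_write {Γ : Type} [Inhabited Γ] (l r : List Γ) (b : Γ) :
    (Tape.mk₂ l r).write b = Tape.mk₂ l (b :: r.tail) := by
  simp only [Tape.mk₂, Tape.write_mk', ListBlank.tail_mk, ListBlank.cons_mk]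

theorem mk₂_move_right {Γ : Type} [Inhabited Γ] (l r : List Γ) (a : Γ) :
    (Tape.mk₂ l (a :: r)).move .right = Tape.mk₂ (a :: l) r := by
  simp only [Tape.mk₂, Tape.move_right_mk', ListBlank.head_mk, ListBlank.tail_mk,
    ListBlank.cons_mk, List.headI, List.tail]

theorem mk₂_move_left {Γ : Type} [Inhabited Γ] (l r : List Γ) (a : Γ) :
    (Tape.mk₂ (a :: l) r).move .left = Tape.mk₂ l (a :: r) := by
  simp only [Tape.mk₂, Tape.move_left_mk', ListBlank.head_mk, ListBlank.tail_mk,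
    ListBlank.cons_mk, List.headI, List.tail]

theorem mk₂_nil_move_left {Γ : Type} [Inhabited Γ] (r : List Γ) :
    (Tape.mk₂ [] r).move .left = Tape.mk₂ [] (default :: r) := by
  simp only [Tape.mk₂, Tape.move_left_mk', ListBlank.head_mk, ListBlank.tail_mk,
    ListBlank.cons_mk, List.headI, List.tail]

theorem mk₂_default_left {Γ : Type} [Inhabited Γ] (r : List Γ) :
    Tape.mk₂ [default] r = Tape.mk₂ [] r := by
  simp only [Tape.mk₂, ListBlank_mk_default]

namespace RevMachine

/-- A pair as a function on `Bool`. -/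
def pr {α : Type} (x y : α) : Bool → α := fun b => cond b y x

variable {Γ : Type} [Inhabited Γ]

/-- A reversible machine with two tapes. -/
def ofPair (Q : Type) [Finite Q] (start halt : Q) (d₀ d₁ : Q → Option Turing.Dir)
    (w : Q → Γ → Γ → Q → Γ → Γ → Prop)
    (fwd : ∀ q x y q₁ x₁ y₁ q₂ x₂ y₂, w q x y q₁ x₁ y₁ → w q x y q₂ x₂ y₂ →
      q₁ = q₂ ∧ x₁ = x₂ ∧ y₁ = y₂)
    (bwd : ∀ q x y q₁ x₁ y₁ q₂ x₂ y₂, w q₁ x₁ y₁ q x y → w q₂ x₂ y₂ q x y →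
      q₁ = q₂ ∧ x₁ = x₂ ∧ y₁ = y₂)
    (start_in : ∀ q x y x' y', ¬ w q x y start x' y')
    (halt_out : ∀ x y q x' y', ¬ w halt x y q x' y')
    (d_start : d₀ start = none ∧ d₁ start = none) (d_halt : d₀ halt = none ∧ d₁ halt = none) :
    RevMachine Bool Γ where
  Q := Q
  start := start
  halt := halt
  d q := pr (d₀ q) (d₁ q)
  W q a q' b := w q (a false) (a true) q' (b false) (b true)
  fwd h h' := by
    obtain ⟨h1, h2, h3⟩ := fwd _ _ _ _ _ _ _ _ _ h h'
    exact ⟨h1, funext fun b => by cases b <;> assumption⟩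
  bwd h h' := by
    obtain ⟨h1, h2, h3⟩ := bwd _ _ _ _ _ _ _ _ _ h h'
    exact ⟨h1, funext fun b => by cases b <;> assumption⟩
  start_in := start_in _ _ _ _ _
  halt_out := halt_out _ _ _ _ _
  d_start k := by cases k <;> simp [pr, d_start]
  d_halt k := by cases k <;> simp [pr, d_halt]

/-- One step of a machine with two tapes. -/
def PairStep {Q : Type} (d₀ d₁ : Q → Option Turing.Dir) (w : Q → Γ → Γ → Q → Γ → Γ → Prop)
    (c c' : Q × Tape Γ × Tape Γ) : Prop :=
  ∃ x y, w c.1 c.2.1.head c.2.2.head c'.1 x y ∧ c'.2.1 = moveHead (d₀ c'.1) (c.2.1.write x) ∧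
    c'.2.2 = moveHead (d₁ c'.1) (c.2.2.write y)

theorem PairStep.mk {Q : Type} {d₀ d₁ : Q → Option Turing.Dir} {w : Q → Γ → Γ → Q → Γ → Γ → Prop}
    {q q' : Q} {X Y X' Y' : Tape Γ} (a b x y : Γ) (h : w q a b q' x y)
    (ha : X.head = a) (hb : Y.head = b)
    (hX : moveHead (d₀ q') (X.write x) = X') (hY : moveHead (d₁ q') (Y.write y) = Y') :
    PairStep d₀ d₁ w (q, X, Y) (q', X', Y') :=
  ⟨x, y, by subst ha hb; exact h, hX.symm, hY.symm⟩

theorem ofPair_runs {Q : Type} [Finite Q] {start halt : Q} {d₀ d₁ : Q → Option Turing.Dir}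
    {w : Q → Γ → Γ → Q → Γ → Γ → Prop} {h1 h2 h3 h4 h5 h6} {X Y X' Y' : Tape Γ}
    (h : ReflTransGen (PairStep d₀ d₁ w) (start, X, Y) (halt, X', Y')) :
    (ofPair Q start halt d₀ d₁ w h1 h2 h3 h4 h5 h6).Runs (pr X Y) (pr X' Y') := by
  refine ReflTransGen.lift (p := (ofPair Q start halt d₀ d₁ w h1 h2 h3 h4 h5 h6).Step)
    (fun c : Q × Tape Γ × Tape Γ => (c.1, pr c.2.1 c.2.2)) ?_ _ _ h
  rintro c c' ⟨x, y, hw, hX, hY⟩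
  refine ⟨pr x y, hw, funext fun k => ?_⟩
  cases k
  · exact hX
  · exact hY

/-! ### Copying -/

inductive CopyState
  | start | init | scan | back | last | halt

instance : Finite CopyState :=
  Set.finite_univ_iff.1 ((Set.toFinite {.start, .init, .scan, .back, .last, .halt}).subset
    fun x _ => by cases x <;> simp)

/-- The states `scan` and `back` have a rule for entering and a rule for looping. The former writes
blanks and the latter symbols, which makes the rules injective. The pass `back` demands equal
symbols on both tapes, so the reversed machine erases the second word by comparing it with the
first. -/
inductive CopyRule {A : Type} : CopyState → Option A → Option A → CopyState → Option A → Option A →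
    Prop
  | start (x y) : CopyRule .start x y .init x y
  | init : CopyRule .init none none .scan none none
  | scan (x : A) : CopyRule .scan (some x) none .scan (some x) (some x)
  | turn : CopyRule .scan none none .back none none
  | back (x : A) : CopyRule .back (some x) (some x) .back (some x) (some x)
  | finish : CopyRule .back none none .last none none
  | last (x y) : CopyRule .last x y .halt x y

def copyDir : CopyState → Option Turing.Dir
  | .init => some .left
  | .scan => some .right
  | .back => some .left
  | .last => some .right
  | _ => none

/-- Copies a word from the first tape to the second one. -/
def copy (A : Type) : RevMachine Bool (Option A) :=
  ofPair CopyState .start .halt copyDir copyDir CopyRule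
    (by rintro q x y q₁ x₁ y₁ q₂ x₂ y₂ h h'; cases h <;> cases h' <;> simp)
    (by rintro q x y q₁ x₁ y₁ q₂ x₂ y₂ h h'; cases h <;> cases h' <;> simp)
    (by rintro q x y x' y' h; cases h)
    (by rintro x y q x' y' h; cases h)
    ⟨rfl, rfl⟩ ⟨rfl, rfl⟩

variable {A : Type}

/-- The tape that holds the word `l`, the head on its first symbol. -/
def wordTape (l : List A) : Tape (Option A) := Tape.mk₂ [] (l.map some)

theorem wordTape_nil_write : (wordTape ([] : List A)).write none = wordTape [] :=
  Tape.write_self (wordTape [])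

theorem mk₂_none_move_right (r : List (Option A)) :
    (Tape.mk₂ [] (none :: r)).move .right = Tape.mk₂ [] r :=
  (mk₂_move_right _ _ _).trans (mk₂_default_left _)

theorem mk₂_none_move_left (r : List (Option A)) :
    (Tape.mk₂ [] r).move .left = Tape.mk₂ [] (none :: r) := mk₂_nil_move_left r

theorem copy_back (l r : List A) :
    ReflTransGen (PairStep copyDir copyDir CopyRule)
      (.back, (Tape.mk₂ (l.map some) (r.map some)).move .left,
        (Tape.mk₂ (l.map some) (r.map some)).move .left)
      (.halt, wordTape (l.reverse ++ r), wordTape (l.reverse ++ r)) := by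
  induction l generalizing r with
  | nil =>
    refine .head (b := (.last, wordTape r, wordTape r)) (.mk _ _ _ _ .finish ?_ ?_ ?_ ?_)
      (.single (.mk _ _ _ _ (.last _ _) rfl rfl (by exact Tape.write_self _)
        (by exact Tape.write_self _))) <;>
    simp [mk₂_none_move_left, mk₂_head, mk₂_write, copyDir, moveHead,
      List.headI, mk₂_none_move_right, wordTape]
  | cons a l ih =>
    have := ih (a :: r)
    refine .head (.mk _ _ _ _ (.back a) ?_ ?_ rfl rfl) ?_
    · simp only [List.map_cons, mk₂_move_left, mk₂_head, List.headI]
    · simp only [List.map_cons, mk₂_move_left, mk₂_head, List.headI]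
    · simpa [List.map_cons, mk₂_move_left, mk₂_write, copyDir, moveHead] using this

theorem copy_scan (l r : List A) :
    ReflTransGen (PairStep copyDir copyDir CopyRule)
      (.scan, Tape.mk₂ (l.map some) (r.map some), Tape.mk₂ (l.map some) [])
      (.halt, wordTape (l.reverse ++ r), wordTape (l.reverse ++ r)) := by
  induction r generalizing l with
  | nil =>
    have h : (Tape.mk₂ (l.map some) []).write (none : Option A) = Tape.mk₂ (l.map some) [] :=
      Tape.write_self (Tape.mk₂ (l.map some) [])
    have := copy_back l []
    refine .head (.mk _ _ _ _ .turn rfl rfl rfl rfl) ?_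
    rw [List.map_nil, h]
    exact this
  | cons a r ih =>
    have := ih (a :: l)
    refine .head (.mk _ _ _ _ (.scan a) rfl rfl rfl rfl) ?_
    simpa [mk₂_write, copyDir, moveHead, mk₂_move_right] using this

theorem copy_runs (l : List A) :
    (copy A).Runs (pr (wordTape l) (wordTape [])) (pr (wordTape l) (wordTape l)) := by
  refine ofPair_runs ?_
  refine .head (.mk _ _ _ _ (.start _ _) rfl rfl rfl rfl) ?_
  rw [Tape.write_self, Tape.write_self]
  refine .head (b := (.scan, wordTape l, wordTape [])) (.mk _ _ _ _ .init ?_ ?_ ?_ ?_) ?_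
  iterate 4
    simp only [copyDir, moveHead, wordTape, mk₂_none_move_left, mk₂_head, List.headI, mk₂_write,
      List.tail, mk₂_none_move_right]
  exact copy_scan [] l

/-! ### Changing the encoding -/

inductive EncodeState
  | start | init | push | scan | mark | back | last | halt

instance : Finite EncodeState :=
  Set.finite_univ_iff.1 ((Set.toFinite
    {.start, .init, .push, .scan, .mark, .back, .last, .halt}).subset
    fun x _ => by cases x <;> simp)

/-- The target is the numeral format of `Turing.PartrecToTM2`: binary digits with the least
significant first, then an end marker. The number `strNum u + 1` has the digits of u behind a
leading 1, whence the reversal and the additional `x true`. What is written on the second tape (`m`,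
some `x b` or a blank) tells which rule led into a state. -/
inductive EncodeRule {A : Type} (i x : Bool → A) (m : A) :
    EncodeState → Option A → Option A → EncodeState → Option A → Option A → Prop
  | start (a b) : EncodeRule i x m .start a b .init a b
  | init (a) : EncodeRule i x m .init a none .push a (some m)
  | push (b) : EncodeRule i x m .push (some (i b)) none .push none (some (x b))
  | turn : EncodeRule i x m .push none none .scan none none
  | scan (a b) : EncodeRule i x m .scan a (some (x b)) .scan a (some (x b))
  | top (a) : EncodeRule i x m .scan a (some m) .mark a (some (x true))
  | mark (a) : EncodeRule i x m .mark a none .back a (some m)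
  | back (a b) : EncodeRule i x m .back a (some (x b)) .back a (some (x b))
  | finish (a) : EncodeRule i x m .back a none .last a none
  | last (a b) : EncodeRule i x m .last a b .halt a b

def encodeDir₀ : EncodeState → Option Turing.Dir
  | .init => some .left
  | .push => some .right
  | _ => none

def encodeDir₁ : EncodeState → Option Turing.Dir
  | .push => some .left
  | .scan => some .right
  | .mark => some .right
  | .back => some .left
  | .last => some .right
  | _ => none

/-- Moves a word of bits `i b` from the first tape to the second one, where it is reversed, written
with the bits `x b`, and followed by `x true` and the end marker `m`. -/
def encode (i x : Bool → A) (m : A) (hi : Function.Injective i) (hx : Function.Injective x)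
    (hm : ∀ b, x b ≠ m) : RevMachine Bool (Option A) :=
  ofPair EncodeState .start .halt encodeDir₀ encodeDir₁ (EncodeRule i x m)
    (by
      rintro q a b q₁ a₁ b₁ q₂ a₂ b₂ h h'
      generalize ha : a = a' at h'
      generalize hb : b = b' at h'
      cases h <;> cases h' <;> simp_all [hi.eq_iff, hx.eq_iff, eq_comm])
    (by
      rintro q a b q₁ a₁ b₁ q₂ a₂ b₂ h h'
      generalize ha : a = a' at h'
      generalize hb : b = b' at h'
      cases h <;> cases h' <;> simp_all [hi.eq_iff, hx.eq_iff, eq_comm])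
    (by rintro q x y x' y' h; cases h)
    (by rintro x y q x' y' h; cases h)
    ⟨rfl, rfl⟩ ⟨rfl, rfl⟩

section

variable {i x : Bool → A} {m : A}

theorem encode_back (l : List Bool) (r : List A) :
    ReflTransGen (PairStep encodeDir₀ encodeDir₁ (EncodeRule i x m))
      (.back, wordTape [], (Tape.mk₂ ((l.map x).map some) (r.map some)).move .left)
      (.halt, wordTape [], wordTape ((l.map x).reverse ++ r)) := by
  induction l generalizing r with
  | nil =>
    refine .head (b := (.last, wordTape [], wordTape r))
      (.mk _ _ _ _ (.finish none) rfl ?_ (by exact wordTape_nil_write) ?_)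
      (.single (.mk _ _ _ _ (.last _ _) rfl rfl (by exact Tape.write_self _)
        (by exact Tape.write_self _))) <;>
    simp [mk₂_none_move_left, mk₂_head, mk₂_write, encodeDir₁, moveHead, List.headI,
      mk₂_none_move_right, wordTape]
  | cons a l ih =>
    have := ih (x a :: r)
    refine .head (.mk _ _ _ _ (.back none a) rfl ?_ (by exact wordTape_nil_write) rfl) ?_
    · simp only [List.map_cons, mk₂_move_left, mk₂_head, List.headI]
    · simpa [List.map_cons, mk₂_move_left, mk₂_write, encodeDir₁, moveHead] using this

theorem encode_scan (l r : List Bool) :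
    ReflTransGen (PairStep encodeDir₀ encodeDir₁ (EncodeRule i x m))
      (.scan, wordTape [], Tape.mk₂ ((l.map x).map some) (((r.map x) ++ [m]).map some))
      (.halt, wordTape [], wordTape (((l.reverse ++ r) ++ [true]).map x ++ [m])) := by
  induction r generalizing l with
  | nil =>
    have := encode_back (i := i) (x := x) (m := m) (true :: l) [m]
    refine .head (b := (.mark, wordTape [], Tape.mk₂ (((true :: l).map x).map some) []))
      (.mk _ _ _ _ (.top none) rfl rfl (by exact wordTape_nil_write) ?_) ?_
    · simp only [List.map_nil, List.nil_append, List.map_cons, mk₂_write, List.tail, encodeDir₁,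
        moveHead, mk₂_move_right]
    refine .head (.mk _ _ _ _ (.mark none) rfl rfl (by exact wordTape_nil_write) rfl) ?_
    simpa [mk₂_write, encodeDir₁, moveHead] using this
  | cons a r ih =>
    have := ih (a :: l)
    refine .head (.mk _ _ _ _ (.scan none a) rfl rfl (by exact wordTape_nil_write) rfl) ?_
    simpa [mk₂_write, encodeDir₁, moveHead, mk₂_move_right] using this

/-- Invariant of the transfer: the second head waits on the blank left of the word collected so far,
so each new bit is put in front and the order is reversed. -/
theorem encode_push (u acc : List Bool) :
    ReflTransGen (PairStep encodeDir₀ encodeDir₁ (EncodeRule i x m))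
      (.push, wordTape (u.map i), Tape.mk₂ [] (none :: ((acc.map x) ++ [m]).map some))
      (.halt, wordTape [], wordTape ((u.reverse ++ acc ++ [true]).map x ++ [m])) := by
  induction u generalizing acc with
  | nil =>
    refine .head (b := (.scan, wordTape [], Tape.mk₂ [] (((acc.map x) ++ [m]).map some)))
      (.mk _ _ _ _ .turn rfl rfl (by exact wordTape_nil_write) ?_) (encode_scan [] acc)
    simp only [mk₂_write, encodeDir₁, moveHead, List.tail, mk₂_none_move_right]
  | cons a u ih =>
    have := ih (a :: acc)
    refine .head (b := (.push, wordTape (u.map i),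
        Tape.mk₂ [] (none :: (((a :: acc).map x) ++ [m]).map some)))
      (.mk _ _ _ _ (.push a) rfl rfl ?_ ?_) (by simpa using this)
    · simp only [wordTape, List.map_cons, mk₂_write, encodeDir₀, moveHead, List.tail,
        mk₂_none_move_right]
    · simp only [List.map_cons, mk₂_write, encodeDir₁, moveHead, List.tail, mk₂_none_move_left,
        List.cons_append]

theorem encode_runs {hi : Function.Injective i} {hx : Function.Injective x} {hm : ∀ b, x b ≠ m}
    (u : List Bool) :
    (encode i x m hi hx hm).Runs (pr (wordTape (u.map i)) (wordTape []))
      (pr (wordTape []) (wordTape ((u.reverse ++ [true]).map x ++ [m]))) := by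
  refine ofPair_runs ?_
  refine .head (b := (.init, Tape.mk₂ [] (none :: (u.map i).map some), wordTape []))
    (.mk _ _ _ _ (.start _ _) rfl rfl ?_ (by exact Tape.write_self _)) ?_
  · rw [Tape.write_self]
    exact mk₂_none_move_left _
  refine .head (b := (.push, wordTape (u.map i), Tape.mk₂ [] [none, some m]))
    (.mk _ _ _ _ (.init none) rfl rfl ?_ ?_) ?_
  · simp only [mk₂_write, encodeDir₀, moveHead, List.tail, mk₂_none_move_right, wordTape]
  · simp only [wordTape, mk₂_write, encodeDir₁, moveHead, List.tail, List.map_nil,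
      mk₂_none_move_left]
  · have := encode_push (i := i) (x := x) (m := m) u []
    simpa using this

end

end RevMachine

end

/-! ## Reversible simulation of stack machines with a history tape -/

section

open Turing (Tape ListBlank)
open TuringMachine (moveHead)
open Relation

namespace RevMachine

/-- What a stack machine does to the stack that it reads. -/
inductive StackAct (G : Type)
  | keep | pop | push (c : G)

/-- The stack after an action. -/
def StackAct.apply {G : Type} : StackAct G → List G → List G
  | keep, l => l
  | pop, l => l.tail
  | push c, l => c :: l

/-- The head movement that belongs to an action. -/
def StackAct.dir {G : Type} : StackAct G → Option G → Option Turing.Dir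
  | pop, some _ => some .right
  | push _, _ => some .left
  | _, _ => none

/-- The symbol written in the first half of an action when `x` is read. -/
def StackAct.erase {G α : Type} : StackAct G → Option α → Option α
  | pop, _ => none
  | _, x => x

variable {I G P A : Type} [DecidableEq I]

/-- A program of a stack machine: in every state it reads the top of one stack and stops there,
or changes its state and acts on this stack. -/
abbrev StackProgram (I G P : Type) : Type := P → Option (I × (Option G → P × StackAct G))

/-- One step of a stack machine. -/
def StackStep (tr : StackProgram I G P) (c c' : P × (I → List G)) : Prop :=
  ∃ k f, tr c.1 = some (k, f) ∧ c'.1 = (f (c.2 k).head?).1 ∧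
    c'.2 = Function.update c.2 k ((f (c.2 k).head?).2.apply (c.2 k))

inductive HistState (F : Set P) (G : Type)
  | start
  | run (q : F)
  | act (q : F) (x : Option G)
  | last
  | halt

instance {F : Set P} [Finite F] [Finite G] : Finite (HistState F G) := by
  let f : HistState F G → Option (Option (Option (F ⊕ F × Option G))) := fun s => match s with
    | .start => none
    | .halt => some none
    | .last => some (some none)
    | .run q => some (some (some (.inl q)))
    | .act q x => some (some (some (.inr (q, x))))
  refine Finite.of_injective f fun s t h => ?_
  cases s <;> cases t <;> simp_all [f]

/-- A step of the stack machine is split in two. The first half records the old state and the symbol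
read in a blank history cell and erases a popped symbol; the second half writes a pushed symbol and
moves the history head to the next blank. The record identifies the predecessor, and a blank history
cell identifies the entry through `start`. Only states from `F` occur, since the state set of a
machine has to be finite. -/
inductive HistRule (tr : StackProgram I G P) {F : Set P} (q₀ qₕ : F) (g : G → A)
    (hs : F × Option G → A) : HistState F G → (Option I → Option A) →
      HistState F G → (Option I → Option A) → Prop
  | start {a} : a none = none → HistRule tr q₀ qₕ g hs .start a (.run q₀) a
  | run {q : F} {k f x a b} : tr q = some (k, f) → a none = none → a (some k) = x.map g →
      b = Function.update (Function.update a none (some (hs (q, x)))) (some k)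
        ((f x).2.erase (x.map g)) → HistRule tr q₀ qₕ g hs (.run q) a (.act q x) b
  | push {q q' : F} {k f x c a b} : tr q = some (k, f) → f x = (q'.1, .push c) →
      a none = some (hs (q, x)) → a (some k) = none →
      b = Function.update a (some k) (some (g c)) → HistRule tr q₀ qₕ g hs (.act q x) a (.run q') b
  | act {q q' : F} {k f x a} : tr q = some (k, f) → (f x).1 = q' → (∀ c, (f x).2 ≠ .push c) →
      a none = some (hs (q, x)) → HistRule tr q₀ qₕ g hs (.act q x) a (.run q') a
  | finish {a} : a none = none → HistRule tr q₀ qₕ g hs (.run qₕ) a .last a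
  | last {a} : HistRule tr q₀ qₕ g hs .last a .halt a

/-- The head movements of the simulation; the history is on the tape `none`. -/
def histDir (tr : StackProgram I G P) {F : Set P} :
    HistState F G → Option I → Option Turing.Dir
  | .run _, none => some .left
  | .last, none => some .right
  | .act q x, some k => match tr q with
    | some (k', f) => if k = k' then (f x).2.dir x else none
    | none => none
  | _, _ => none

/-- The reversible machine that runs a stack machine and writes its history on the tape `none`. -/
def history (tr : StackProgram I G P) {F : Set P} [Finite F] [Finite G] (q₀ qₕ : F)
    (hₕ : tr qₕ = none) (g : G → A) (hg : Function.Injective g) (hs : F × Option G → A)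
    (hhs : Function.Injective hs) : RevMachine (Option I) (Option A) where
  Q := HistState F G
  start := .start
  halt := .halt
  d := histDir tr
  W := HistRule tr q₀ qₕ g hs
  fwd h h' := by
    cases h with
    | start h => cases h' with | start h' => exact ⟨rfl, rfl⟩
    | run h1 h2 h3 h4 =>
      cases h' with
      | run h1' h2' h3' h4' =>
        obtain ⟨rfl, rfl⟩ := Prod.mk.inj (Option.some.inj (h1.symm.trans h1'))
        obtain rfl := Option.map_injective hg (h3.symm.trans h3')
        exact ⟨rfl, h4.trans h4'.symm⟩
      | finish => simp [hₕ] at h1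
    | push h1 h2 h3 h4 h5 =>
      cases h' with
      | push h1' h2' h3' h4' h5' =>
        obtain ⟨rfl, rfl⟩ := Prod.mk.inj (Option.some.inj (h1.symm.trans h1'))
        obtain ⟨e, e'⟩ := Prod.mk.inj (h2.symm.trans h2')
        obtain rfl := Subtype.ext e
        cases e'
        exact ⟨rfl, h5.trans h5'.symm⟩
      | act h1' h2' h3' h4' =>
        obtain ⟨rfl, rfl⟩ := Prod.mk.inj (Option.some.inj (h1.symm.trans h1'))
        exact absurd (by rw [h2]) (h3' _)
    | act h1 h2 h3 h4 =>
      cases h' with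
      | push h1' h2' h3' h4' h5' =>
        obtain ⟨rfl, rfl⟩ := Prod.mk.inj (Option.some.inj (h1.symm.trans h1'))
        exact absurd (by rw [h2']) (h3 _)
      | act h1' h2' h3' h4' =>
        obtain ⟨rfl, rfl⟩ := Prod.mk.inj (Option.some.inj (h1.symm.trans h1'))
        obtain rfl := Subtype.ext (h2.symm.trans h2')
        exact ⟨rfl, rfl⟩
    | finish h =>
      cases h' with
      | run h1' => simp [hₕ] at h1'
      | finish => exact ⟨rfl, rfl⟩
    | last => cases h' with | last => exact ⟨rfl, rfl⟩
  bwd h h' := by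
    cases h with
    | start h =>
      cases h' with
      | start => exact ⟨rfl, rfl⟩
      | push _ _ h3 _ h5 =>
        rw [h5, Function.update_of_ne (by simp), h3] at h
        simp at h
      | act _ _ _ h4 => simp [h4] at h
    | @run q k f x a b h1 h2 h3 h4 =>
      cases h' with
      | @run _ k' f' _ a' _ h1' h2' h3' h4' =>
        obtain ⟨rfl, rfl⟩ := Prod.mk.inj (Option.some.inj (h1.symm.trans h1'))
        refine ⟨rfl, funext fun i => ?_⟩
        have e := congrFun (h4.symm.trans h4') i
        rcases i with _ | i
        · rw [h2, h2']
        · by_cases hi : i = k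
          · rw [hi, h3, h3']
          · simpa [Function.update_apply, hi] using e
    | @push q q' k f x c a b h1 h2 h3 h4 h5 =>
      cases h' with
      | start h =>
        rw [h5, Function.update_of_ne (by simp), h3] at h
        simp at h
      | @push _ _ k' f' x' c' a' _ h1' h2' h3' h4' h5' =>
        have e := congrFun (h5.symm.trans h5') none
        rw [Function.update_of_ne (by simp), Function.update_of_ne (by simp), h3, h3'] at e
        obtain ⟨rfl, rfl⟩ := Prod.mk.inj (hhs (Option.some.inj e))
        obtain ⟨rfl, rfl⟩ := Prod.mk.inj (Option.some.inj (h1.symm.trans h1'))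
        refine ⟨rfl, funext fun i => ?_⟩
        have e := congrFun (h5.symm.trans h5') i
        by_cases hi : i = some k
        · rw [hi, h4, h4']
        · simpa [Function.update_apply, hi] using e
      | act h1' h2' h3' h4' =>
        rw [h5, Function.update_of_ne (by simp), h3] at h4'
        obtain ⟨rfl, rfl⟩ := Prod.mk.inj (hhs (Option.some.inj h4'))
        obtain ⟨rfl, rfl⟩ := Prod.mk.inj (Option.some.inj (h1.symm.trans h1'))
        exact absurd (by rw [h2]) (h3' _)
    | act h1 h2 h3 h4 =>
      cases h' with
      | start h => simp [h4] at h
      | push h1' h2' h3' h4' h5' =>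
        rw [h5', Function.update_of_ne (by simp), h3'] at h4
        obtain ⟨rfl, rfl⟩ := Prod.mk.inj (hhs (Option.some.inj h4))
        obtain ⟨rfl, rfl⟩ := Prod.mk.inj (Option.some.inj (h1.symm.trans h1'))
        exact absurd (by rw [h2']) (h3 _)
      | act h1' h2' h3' h4' =>
        obtain ⟨rfl, rfl⟩ := Prod.mk.inj (hhs (Option.some.inj (h4.symm.trans h4')))
        exact ⟨rfl, rfl⟩
    | finish h => cases h' with | finish => exact ⟨rfl, rfl⟩
    | last => cases h' with | last => exact ⟨rfl, rfl⟩
  start_in h := by cases h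
  halt_out h := by cases h
  d_start k := by cases k <;> rfl
  d_halt k := by cases k <;> rfl

theorem wordTape_head (l : List G) (g : G → A) :
    (wordTape (l.map g)).head = l.head?.map g := by
  cases l <;> rfl

section

variable {tr : StackProgram I G P} {F : Set P} [Finite F] [Finite G] {q₀ qₕ : F}
  {hₕ : tr qₕ = none} {g : G → A} {hg : Function.Injective g} {hs : F × Option G → A}
  {hhs : Function.Injective hs}

/-- Tapes that hold the stacks `S` and, on the tape `none`, `H`. -/
def stackTapes (g : G → A) (S : I → List G) (H : Tape (Option A)) :
    Option I → Tape (Option A)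
  | none => H
  | some k => wordTape ((S k).map g)

theorem history_step {q q' : F} {S S' : I → List G} (h : StackStep tr (q.1, S) (q'.1, S'))
    (w : List (Option A)) : ∃ w' : List (Option A),
    ReflTransGen (history tr q₀ qₕ hₕ g hg hs hhs).Step
      (HistState.run q, stackTapes g S (Tape.mk₂ [] (none :: w)))
      (HistState.run q', stackTapes g S' (Tape.mk₂ [] (none :: w'))) := by
  obtain ⟨k, f, h1, h2, h3⟩ := h
  simp only at h1 h2 h3
  set x := (S k).head? with hx
  refine ⟨some (hs (q, x)) :: w, ?_⟩
  -- the stack after the first half of the step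
  set U : Tape (Option A) := moveHead ((f x).2.dir x)
    ((wordTape ((S k).map g)).write ((f x).2.erase (x.map g))) with hU
  refine .head (b := (HistState.act q x, Function.update
      (stackTapes g S (Tape.mk₂ [] (some (hs (q, x)) :: w))) (some k) U))
    ⟨_, HistRule.run h1 rfl (wordTape_head _ _) rfl, ?_⟩ (.single ?_)
  · funext i
    rcases i with _ | i
    · rfl
    · by_cases hi : i = k
      · subst hi
        simp [history, histDir, h1, hU, stackTapes]
      · simp [history, histDir, h1, hi, stackTapes, moveHead, Tape.write_self]
  · rcases hfx : f x with ⟨p, act⟩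
    rw [hfx] at h2 h3 hU
    simp only at h2 h3 hU
    subst h3
    rcases act with _ | _ | c
    · refine ⟨_, HistRule.act h1 (by rw [hfx]; exact h2.symm) (by simp [hfx]) rfl, ?_⟩
      funext i
      rcases i with _ | i
      · exact (mk₂_none_move_left _).symm
      · by_cases hi : i = k
        · subst hi
          simp [history, histDir, stackTapes, moveHead, Tape.write_self, StackAct.apply, hU,
            StackAct.dir, StackAct.erase]
          rw [hx, ← wordTape_head, Tape.write_self]
        · simp [history, histDir, hi, stackTapes, moveHead, Tape.write_self]
    · refine ⟨_, HistRule.act h1 (by rw [hfx]; exact h2.symm) (by simp [hfx]) rfl, ?_⟩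
      funext i
      rcases i with _ | i
      · exact (mk₂_none_move_left _).symm
      · by_cases hi : i = k
        · subst hi
          have : U = wordTape ((S i).tail.map g) := by
            rw [hU]
            rcases hS : S i with _ | ⟨c, l⟩
            · simp [hx, hS, StackAct.dir, StackAct.erase, moveHead, wordTape_nil_write]
            · simp [hx, hS, StackAct.dir, StackAct.erase, moveHead, wordTape, mk₂_write,
                mk₂_none_move_right]
          simp [history, histDir, stackTapes, moveHead, Tape.write_self, StackAct.apply, this]
        · simp [history, histDir, hi, stackTapes, moveHead, Tape.write_self]
    · have hU' : U = Tape.mk₂ [] (none :: ((S k).map g).map some) := by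
        rw [hU]
        simp only [StackAct.erase, StackAct.dir, moveHead]
        rw [hx, ← wordTape_head, Tape.write_self, wordTape, mk₂_none_move_left]
      refine ⟨_, HistRule.push h1 (hfx.trans (by rw [h2])) rfl ?_ rfl, ?_⟩
      · simp [hU', mk₂_head]
      funext i
      rcases i with _ | i
      · exact (mk₂_none_move_left _).symm
      · by_cases hi : i = k
        · subst hi
          simp [history, histDir, stackTapes, moveHead, StackAct.apply, hU', mk₂_write, wordTape]
        · simp [history, histDir, hi, stackTapes, moveHead, Tape.write_self]

/-- The closure hypothesis `hF` keeps the simulated states in the finite set `F`; then the halves of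
`history_step` are chained together. -/
theorem history_runs {S S' : I → List G} (h : ReflTransGen (StackStep tr) (q₀.1, S) (qₕ.1, S'))
    (hF : ∀ c c', StackStep tr c c' → c.1 ∈ F → c'.1 ∈ F) :
    ∃ H, (history tr q₀ qₕ hₕ g hg hs hhs).Runs (stackTapes g S (wordTape []))
      (stackTapes g S' H) := by
  have key : ∀ c, ReflTransGen (StackStep tr) (q₀.1, S) c → ∃ (hc : c.1 ∈ F) (w : List (Option A)),
      ReflTransGen (history tr q₀ qₕ hₕ g hg hs hhs).Step
        (HistState.run q₀, stackTapes g S (Tape.mk₂ [] [none]))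
        (HistState.run ⟨c.1, hc⟩, stackTapes g c.2 (Tape.mk₂ [] (none :: w))) := by
    intro c h
    induction h with
    | refl => exact ⟨q₀.2, [], .refl⟩
    | @tail c c' _ h ih =>
      obtain ⟨hc, w, hw⟩ := ih
      obtain ⟨w', hw'⟩ := history_step (q := ⟨c.1, hc⟩) (q' := ⟨c'.1, hF _ _ h hc⟩)
        (q₀ := q₀) (qₕ := qₕ) (hₕ := hₕ) (g := g) (hg := hg) (hs := hs) (hhs := hhs) h w
      exact ⟨_, w', hw.trans hw'⟩
  obtain ⟨_, w, hw⟩ := key _ h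
  refine ⟨Tape.mk₂ [] w, .head (b := (HistState.run q₀, stackTapes g S (Tape.mk₂ [] [none])))
    ⟨_, HistRule.start rfl, ?_⟩ (.trans hw
    (.head (b := (HistState.last, stackTapes g S' (Tape.mk₂ [] w)))
      ⟨_, HistRule.finish rfl, ?_⟩ (.single ⟨_, HistRule.last, ?_⟩)))⟩
  · funext i
    rcases i with _ | i
    · simp only [history, histDir, Tape.write_self]
      exact (mk₂_none_move_left _).symm
    · simp [history, histDir, Tape.write_self, moveHead, stackTapes]
  · funext i
    rcases i with _ | i
    · simp only [history, histDir, Tape.write_self]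
      exact (mk₂_none_move_right _).symm
    · simp [history, histDir, Tape.write_self, moveHead, stackTapes]
  · funext i
    rcases i with _ | i <;> simp [history, histDir, Tape.write_self, moveHead, stackTapes]

end

/-! ### Programs with local variables -/

section

open Turing.TM2

variable {Λ σ : Type} [Inhabited I]

/-- The statements of a `TM2` program as states of a stack machine. -/
def microProgram (M : Λ → Stmt (fun _ : I => G) Λ σ) :
    StackProgram I G (Stmt (fun _ : I => G) Λ σ × σ)
  | (.push k f s, v) => some (k, fun _ => ((s, v), .push (f v)))
  | (.peek k f s, v) => some (k, fun a => ((s, f v a), .keep))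
  | (.pop k f s, v) => some (k, fun a => ((s, f v a), .pop))
  | (.load f s, v) => some (default, fun _ => ((s, f v), .keep))
  | (.branch f s s', v) => some (default, fun _ => (cond (f v) (s, v) (s', v), .keep))
  | (.goto l, v) => some (default, fun _ => ((M (l v), v), .keep))
  | (.halt, _) => none

/-- The state of the stack machine in a configuration of a `TM2` program. -/
def microCfg (M : Λ → Stmt (fun _ : I => G) Λ σ) (c : Cfg (fun _ : I => G) Λ σ) :
    (Stmt (fun _ : I => G) Λ σ × σ) × (I → List G) :=
  ((match c.l with
    | some l => M l
    | none => .halt, c.var), c.stk)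

/-- Statements that touch no stack are modelled as reading the `default` stack and keeping it,
whence the uses of `Function.update_eq_self`. -/
theorem microProgram_stepAux (M : Λ → Stmt (fun _ : I => G) Λ σ) (s : Stmt (fun _ : I => G) Λ σ)
    (v : σ) (S : I → List G) :
    ReflTransGen (StackStep (microProgram M)) ((s, v), S) (microCfg M (stepAux s v S)) := by
  induction s generalizing v S with
  | push k f s ih => exact .head ⟨_, _, rfl, rfl, rfl⟩ (ih _ _)
  | peek k f s ih => exact .head (b := ((s, f v (S k).head?), S)) ⟨_, _, rfl, rfl, (Function.update_eq_self _ _).symm⟩ (ih _ _)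
  | pop k f s ih => exact .head ⟨_, _, rfl, rfl, rfl⟩ (ih _ _)
  | load f s ih => exact .head (b := ((s, f v), S)) ⟨_, _, rfl, rfl, (Function.update_eq_self _ _).symm⟩ (ih _ _)
  | branch f s s' ih ih' =>
    rcases h : f v with _ | _
    · refine .head (b := ((s', v), S)) ⟨_, _, rfl, ?_, (Function.update_eq_self _ _).symm⟩ ?_
      · simp [h]
      · simpa [stepAux, h] using ih' v S
    · refine .head (b := ((s, v), S)) ⟨_, _, rfl, ?_, (Function.update_eq_self _ _).symm⟩ ?_
      · simp [h]
      · simpa [stepAux, h] using ih v S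
  | goto l => exact .single ⟨_, _, rfl, rfl, (Function.update_eq_self _ _).symm⟩
  | halt => exact .refl

theorem microProgram_reaches {M : Λ → Stmt (fun _ : I => G) Λ σ}
    {c c' : Cfg (fun _ : I => G) Λ σ} (h : StateTransition.Reaches (step M) c c') :
    ReflTransGen (StackStep (microProgram M)) (microCfg M c) (microCfg M c') := by
  induction h with
  | refl => exact .refl
  | @tail c c' _ h ih =>
    refine ih.trans ?_
    rcases c with ⟨_ | l, v, S⟩
    · simp [step] at h
    · simp only [step, Option.mem_def, Option.some.injEq] at h
      subst h
      exact microProgram_stepAux M _ _ _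

/-- Supplies the closed finite set of states that the history machine needs: substatements of
supported statements stay in `stmts M L`, and jumps stay there by `Supports`. -/
theorem microProgram_closed [Inhabited Λ] {M : Λ → Stmt (fun _ : I => G) Λ σ} {L : Finset Λ}
    (hL : Supports M L) {c c' : (Stmt (fun _ : I => G) Λ σ × σ) × (I → List G)}
    (h : StackStep (microProgram M) c c') (hc : some c.1.1 ∈ stmts M L) :
    some c'.1.1 ∈ stmts M L := by
  obtain ⟨k, f, h1, h2, -⟩ := h
  obtain ⟨⟨s, v⟩, S⟩ := c
  simp only at hc h1 h2
  rw [h2]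
  cases s <;> simp only [microProgram, Option.some.injEq, Prod.mk.injEq, reduceCtorEq] at h1 <;>
    obtain ⟨rfl, rfl⟩ := h1
  case branch f s s' =>
    rcases h : f v
    · exact stmts_trans (by simp [stmts₁, stmts₁_self]) hc
    · exact stmts_trans (by simp [stmts₁, stmts₁_self]) hc
  case goto l =>
    have := stmts_supportsStmt hL hc v
    simp only [stmts, Finset.some_mem_insertNone, Finset.mem_biUnion]
    exact ⟨_, this, stmts₁_self⟩
  all_goals exact stmts_trans (by simp [stmts₁, stmts₁_self]) hc

end

end RevMachine

end

/-! ## Reversible machines for partial recursive injections -/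

section

open Turing (Tape)
open Turing.PartrecToTM2 (Γ' K' trNat trNum trPosNum trList)

/-- The bits of the stack alphabet of `Turing.PartrecToTM2`. -/
def bitSymbol : Bool → Γ'
  | true => .bit1
  | false => .bit0

theorem bitSymbol_injective : Function.Injective bitSymbol := by
  intro a b h
  cases a <;> cases b <;> simp_all [bitSymbol]

theorem bitSymbol_ne_cons (b : Bool) : bitSymbol b ≠ .cons := by
  cases b <;> simp [bitSymbol]

theorem trNat_bit (b : Bool) (m : ℕ) (hm : m ≠ 0) :
    trNat (2 * m + b.toNat) = bitSymbol b :: trNat m := by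
  have h : ((2 * m + b.toNat : ℕ) : Num) = cond b Num.bit1 Num.bit0 (m : Num) := by
    apply Num.to_nat_inj.1
    cases b <;> simp [Num.cast_bit0, Num.cast_bit1] <;> exact Or.inl rfl
  unfold trNat
  rw [h]
  rcases hp : (m : Num) with _ | p
  · have := congrArg (fun n : Num => (n : ℕ)) hp
    simp at this
    exact absurd this hm
  · cases b <;> rfl

/-- Length-lexicographic numbering is binary notation with a suppressed leading 1: `strNum u + 1` is
written 1u. The right side is what `encode` produces before its end marker. -/
theorem trNat_strNum (u : List Bool) :
    trNat (strNum u + 1) = (u.reverse ++ [true]).map bitSymbol := by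
  induction u using List.reverseRecOn with
  | nil => rfl
  | append_singleton s b ih =>
    have : strNum (s ++ [b]) + 1 = 2 * (strNum s + 1) + b.toNat := by
      rw [strNum_append]
      cases b <;> simp <;> omega
    rw [this, trNat_bit _ _ (by omega), ih]
    simp

namespace RevMachine

instance : Inhabited K' := ⟨.main⟩

open Classical Turing.PartrecToTM2 in
/-- Every partial recursive function is computed by a reversible machine that leaves its history
on an extra tape. -/
theorem exists_history_of_partrec {f : ℕ →. ℕ} (hf : Partrec f) :
    ∃ (N : Type) (_ : Finite N), ∀ (A : Type) (g : Γ' → A) (hs : N → A), Function.Injective g →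
      Function.Injective hs → ∃ M : RevMachine (Option K') (Option A), ∀ n m, m ∈ f n →
        ∃ H, M.Runs (stackTapes g (K'.elim (trList [n]) [] [] []) (wordTape []))
          (stackTapes g (K'.elim (trList [m]) [] [] []) H) := by
  obtain ⟨c, hc⟩ := Turing.ToPartrec.Code.exists_code (Nat.Partrec'.part_iff₁.2 hf)
  let _ : Inhabited Λ' := ⟨trNormal c Cont'.halt⟩
  let L := codeSupp c Cont'.halt
  have hL : Turing.TM2.Supports tr L := tr_supports c Cont'.halt
  let F : Set (Turing.TM2.Stmt (fun _ : K' => Γ') Λ' (Option Γ') × Option Γ') :=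
    -- The final configuration has no label; its statement `.halt` is added by hand, as it need not
    -- belong to the support.
    {p | some p.1 ∈ Turing.TM2.stmts tr L ∨ p.1 = .halt}
  have hF : F.Finite := by
    have h1 : {s | some s ∈ Turing.TM2.stmts tr L}.Finite :=
      (Turing.TM2.stmts tr L).finite_toSet.preimage (Option.some_injective _).injOn
    refine ((h1.union (Set.finite_singleton .halt)).prod (Set.finite_univ (α := Option Γ'))).subset
      fun p hp => ⟨hp, trivial⟩
  have : Finite F := hF
  refine ⟨F × Option Γ', inferInstance, fun A g hs hg hhs => ?_⟩
  let q₀ : F := ⟨(tr (trNormal c Cont'.halt), none), Or.inl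
    (Finset.some_mem_insertNone.2 (Finset.mem_biUnion.2 ⟨_, hL.1, Turing.TM2.stmts₁_self⟩))⟩
  let qₕ : F := ⟨(.halt, none), Or.inr rfl⟩
  refine ⟨history (microProgram tr) q₀ qₕ rfl g hg hs hhs, fun n m hm => ?_⟩
  refine history_runs ?_ ?_
  · have h1 : [m] ∈ c.eval [n] := by
      have := hc (n ::ᵥ List.Vector.nil)
      simp only [List.Vector.head_cons] at this
      rw [show (n ::ᵥ List.Vector.nil).1 = [n] from rfl] at this
      rw [this]
      simpa using hm
    have h2 : Turing.PartrecToTM2.halt [m] ∈ StateTransition.eval (Turing.TM2.step tr) (init c [n]) := by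
      rw [tr_eval]
      exact Part.mem_map _ h1
    exact microProgram_reaches (StateTransition.mem_eval.1 h2).1
  · rintro c c' h (hc | hc)
    · exact Or.inl (microProgram_closed hL h hc)
    · obtain ⟨k, f, h1, -⟩ := h
      obtain ⟨⟨s, v⟩, S⟩ := c
      simp only at hc
      subst hc
      simp [microProgram] at h1

/-- The tapes of a machine that computes a partial recursive injection. -/
inductive InjTape
  | io | fst | snd | hist | rev | aux | stack
  deriving DecidableEq

instance : Finite InjTape :=
  Set.finite_univ_iff.1 ((Set.toFinite {.io, .fst, .snd, .hist, .rev, .aux, .stack}).subset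
    fun x _ => by cases x <;> simp)

/-- The contents of the tapes between the stages of the computation. -/
def injTapes {A : Type} (i x y h : Tape (Option A)) : InjTape → Tape (Option A)
  | .io => i
  | .fst => x
  | .snd => y
  | .hist => h
  | _ => wordTape []

/-- The location of the tapes of the history machine that works on the tape `x`. -/
def workTape (x : InjTape) (hx : x = .fst ∨ x = .snd) : Option K' ↪ InjTape where
  toFun
    | none => .hist
    | some .main => x
    | some .rev => .rev
    | some .aux => .aux
    | some .stack => .stack
  inj' := by
    rcases hx with rfl | rfl <;>
    · rintro (_ | _ | _ | _ | _) (_ | _ | _ | _ | _) h <;> simp_all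

/-- The location of two tapes. -/
def twoTapes (x y : InjTape) (h : x ≠ y) : Bool ↪ InjTape where
  toFun := pr x y
  inj' := by
    rintro (_ | _) (_ | _) h' <;> simp_all [pr, eq_comm]

/-- Partial recursive functions `f` and `g` yield a reversible Turing machine that computes `f`
as far as `g` is its inverse. -/
theorem exists_reversible_of_partrec {f g : ℕ →. ℕ} (hf : Partrec f) (hg : Partrec g) :
    ∃ M : TuringMachine, M.IsReversible ∧ ∀ u v : List Bool, strNum v ∈ f (strNum u) →
      strNum u ∈ g (strNum v) → ∃ n, M.ComputesIn n u v := by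
  -- The encoded tapes hold `strNum u + 1` instead of `strNum u`, so both functions are conjugated
  -- by the successor.
  have hs : ∀ {f : ℕ →. ℕ}, Partrec f → Partrec fun n => (f (n - 1)).map Nat.succ := fun hf =>
    (hf.comp (Primrec.pred.to_comp)).map (Primrec.succ.to_comp.comp Computable.snd).to₂
  obtain ⟨N₁, _, h₁⟩ := exists_history_of_partrec (hs hf)
  obtain ⟨N₂, _, h₂⟩ := exists_history_of_partrec (hs hg)
  let S : Type := Γ' ⊕ N₁ ⊕ N₂
  let e : Γ' → Bool ⊕ S := fun a => .inr (.inl a)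
  have he : Function.Injective e := fun a b h => Sum.inl.inj (Sum.inr.inj h)
  obtain ⟨M₁, hM₁⟩ := h₁ (Bool ⊕ S) e (fun a => .inr (.inr (.inl a))) he
    (fun a b h => Sum.inl.inj (Sum.inr.inj (Sum.inr.inj h)))
  obtain ⟨M₂, hM₂⟩ := h₂ (Bool ⊕ S) e (fun a => .inr (.inr (.inr a))) he
    (fun a b h => Sum.inr.inj (Sum.inr.inj (Sum.inr.inj h)))
  let E : RevMachine Bool (Option (Bool ⊕ S)) :=
    encode Sum.inl (fun b => e (bitSymbol b)) (e .cons) Sum.inl_injective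
      (he.comp bitSymbol_injective) (fun b h => bitSymbol_ne_cons b (he h))
  let C : RevMachine Bool (Option (Bool ⊕ S)) := copy (Bool ⊕ S)
  let F₁ := M₁.lift (workTape .fst (.inl rfl))
  let F₂ := M₂.lift (workTape .snd (.inr rfl))
  -- Bennett's scheme, with the contents of (`fst`, `snd`): encode (u, ε); compute f, copy,
  -- uncompute: (u, v); compute g on `snd`: (u, u); uncopy: (ε, u); uncompute g: (ε, v); decode v to
  -- `io`. Reversibility is built into the parts; only correctness needs f and g to be inverse at
  -- the given strings.
  let M : RevMachine InjTape (TapeSymbol S) :=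
    (E.lift (twoTapes .io .fst (by simp))).seq (F₁.seq ((C.lift (twoTapes .fst .snd (by simp))).seq
      (F₁.inv.seq (F₂.seq ((C.lift (twoTapes .snd .fst (by simp))).inv.seq
        (F₂.inv.seq (E.lift (twoTapes .io .snd (by simp))).inv))))))
  refine ⟨M.toTM .io, M.toTM_isReversible .io, fun u v hv hu => Runs.computesIn ?_⟩
  let W : List Bool → Tape (Option (Bool ⊕ S)) := fun u => wordTape (u.map Sum.inl)
  let N : List Bool → Tape (Option (Bool ⊕ S)) := fun u => wordTape ((trList [strNum u + 1]).map e)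
  let o : Tape (Option (Bool ⊕ S)) := wordTape []
  have hN : ∀ u, N u = wordTape ((u.reverse ++ [true]).map (fun b => e (bitSymbol b)) ++ [e .cons]) := by
    intro u
    simp only [N, trList, trNat_strNum]
    simp [Function.comp_def]
  have std : ∀ q u, ((M.toTM .io).stdCfg q u).tape = injTapes (W u) o o o := by
    intro q u
    funext k
    cases k
    · simp only [TuringMachine.stdCfg, injTapes, W, wordTape, List.map_map]
      rfl
    all_goals rfl
  rw [std, std]
  obtain ⟨H₁, hH₁⟩ := hM₁ (strNum u + 1) (strNum v + 1) (by simpa using hv)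
  obtain ⟨H₂, hH₂⟩ := hM₂ (strNum v + 1) (strNum u + 1) (by simpa using hu)
  have r₁ : F₁.Runs (injTapes o (N u) o o) (injTapes o (N v) o H₁) := by
    refine Runs.lift _ ?_ ?_
    · convert hH₁ using 1 <;>
      · funext k
        rcases k with _ | _ | _ | _ | _ <;> rfl
    · rintro (_ | _ | _ | _ | _ | _ | _) hk
      all_goals first | rfl | exact absurd ⟨none, rfl⟩ hk | exact absurd ⟨some .main, rfl⟩ hk
  have r₂ : F₂.Runs (injTapes o (N u) (N v) o) (injTapes o (N u) (N u) H₂) := by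
    refine Runs.lift _ ?_ ?_
    · convert hH₂ using 1 <;>
      · funext k
        rcases k with _ | _ | _ | _ | _ <;> rfl
    · rintro (_ | _ | _ | _ | _ | _ | _) hk
      all_goals first | rfl | exact absurd ⟨none, rfl⟩ hk | exact absurd ⟨some .main, rfl⟩ hk
  have r₂' : F₂.Runs (injTapes o o (N v) o) (injTapes o o (N u) H₂) := by
    refine Runs.lift _ ?_ ?_
    · convert hH₂ using 1 <;>
      · funext k
        rcases k with _ | _ | _ | _ | _ <;> rfl
    · rintro (_ | _ | _ | _ | _ | _ | _) hk
      all_goals first | rfl | exact absurd ⟨none, rfl⟩ hk | exact absurd ⟨some .main, rfl⟩ hk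
  have r₁' : F₁.Runs (injTapes o (N u) (N v) o) (injTapes o (N v) (N v) H₁) := by
    refine Runs.lift _ ?_ ?_
    · convert hH₁ using 1 <;>
      · funext k
        rcases k with _ | _ | _ | _ | _ <;> rfl
    · rintro (_ | _ | _ | _ | _ | _ | _) hk
      all_goals first | rfl | exact absurd ⟨none, rfl⟩ hk | exact absurd ⟨some .main, rfl⟩ hk
  have two : ∀ {R : RevMachine Bool (Option (Bool ⊕ S))} {x y : InjTape} (h : x ≠ y)
      {T T' : InjTape → Tape (Option (Bool ⊕ S))}, R.Runs (pr (T x) (T y)) (pr (T' x) (T' y)) →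
      (∀ k, k ≠ x → k ≠ y → T k = T' k) → (R.lift (twoTapes x y h)).Runs T T' := by
    intro R x y h T T' hR hT
    refine Runs.lift _ ?_ ?_
    · convert hR using 1 <;>
      · funext k
        cases k <;> rfl
    · intro k hk
      exact hT k (fun e => hk ⟨false, e.symm⟩) (fun e => hk ⟨true, e.symm⟩)
  have rE : ∀ u, E.Runs (pr (W u) o) (pr o (N u)) := fun u => by
    rw [hN]
    exact encode_runs u
  have rC : ∀ u, C.Runs (pr (N u) o) (pr (N u) (N u)) := fun u => copy_runs _
  refine Runs.seq (two _ (T' := injTapes o (N u) o o) (rE u) ?_) (Runs.seq r₁ (Runs.seq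
    (two _ (T' := injTapes o (N v) (N v) H₁) (rC v) ?_) (Runs.seq r₁'.inv (Runs.seq r₂
    (Runs.seq (Runs.inv (two _ (T := injTapes o o (N u) H₂) (rC u) ?_)) (Runs.seq r₂'.inv
    (Runs.inv (two _ (rE v) ?_))))))))
  all_goals
    rintro (_ | _ | _ | _ | _ | _ | _) h h' <;> first | rfl | exact absurd rfl h | exact absurd rfl h'

end RevMachine

end

/-! ## Computations of a Turing machine are decidable -/

section

open Turing (Tape ListBlank)

theorem primrec_strNum : Primrec strNum :=
  Primrec.list_foldl .id (.const 0) (Primrec.nat_add.comp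
    (Primrec.nat_mul.comp (.const 2) (Primrec.fst.comp .snd))
    ((Primrec.dom_finite fun b : Bool => if b then 2 else 1).comp (Primrec.snd.comp .snd))).to₂

theorem primrec_numStr : Primrec numStr := by
  have h : Primrec₂ fun (_ : Unit) (n : ℕ) => numStr n := by
    refine Primrec.nat_strong_rec _ (g := fun _ l => if l.length = 0 then some [] else
      some ((l.getD ((l.length - 1) / 2) []) ++ [decide ((l.length - 1) % 2 = 1)])) ?_ ?_
    · have hl : Primrec fun p : Unit × List (List Bool) => p.2.length - 1 :=
        Primrec.pred.comp (Primrec.list_length.comp .snd)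
      have hd : PrimrecPred fun p : Unit × List (List Bool) => (p.2.length - 1) % 2 = 1 :=
        Primrec.eq.comp (Primrec.nat_mod.comp hl (.const 2)) (.const 1)
      exact (Primrec.ite (Primrec.eq.comp (Primrec.list_length.comp .snd) (.const 0))
        (.const (some [])) (Primrec.option_some.comp (Primrec.list_append.comp
          ((Primrec.list_getD []).comp .snd (Primrec.nat_div.comp hl (.const 2)))
          (Primrec.list_cons.comp hd.decide (.const []))))).to₂
    · intro _ n
      rcases n with _ | n
      · simp [numStr]
      · have : n / 2 < n + 1 := by omega
        simp [numStr, this]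
  exact h.comp (.const ()) .id

/-- A primitive recursive coding of a finite type. -/
@[reducible]
noncomputable def finitePrimcodable (α : Type) [Finite α] : Primcodable α :=
  Primcodable.ofEquiv _ (Finite.equivFin α)

theorem primrec_pi {α σ : Type} [Primcodable α] [Primcodable σ] {n : ℕ} {f : α → Fin n → σ}
    (h : ∀ i, Primrec fun a => f a i) : Primrec f :=
  have h' : Primrec₂ fun i a => f a i := Primrec.fin_curry₁.2 h
  Primrec.fin_curry.2 h'.swap

/-! ### Tapes coded by finite lists, up to trailing blanks -/

section

variable {Γ : Type} [Inhabited Γ]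

open Classical in
/-- A word without its trailing blanks. -/
noncomputable def trimBlanks (l : List Γ) : List Γ :=
  l.foldr (fun a acc => if a = default ∧ acc = [] then [] else a :: acc) []

theorem mk_trimBlanks (l : List Γ) : ListBlank.mk (trimBlanks l) = ListBlank.mk l := by
  induction l with
  | nil => rfl
  | cons a l ih =>
    rw [trimBlanks, List.foldr_cons]
    split_ifs with h
    · have h2 : trimBlanks l = [] := h.2
      rw [← ListBlank.cons_mk, ← ih, h2, ListBlank.cons_mk, h.1, ListBlank_mk_default]
    · exact (ListBlank.cons_mk a (trimBlanks l)).symm.trans (by rw [ih, ListBlank.cons_mk])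

theorem trimBlanks_append (l : List Γ) (n : ℕ) :
    trimBlanks (l ++ List.replicate n default) = trimBlanks l := by
  induction l with
  | nil =>
    induction n with
    | zero => rfl
    | succ n ih =>
      rw [List.nil_append] at ih ⊢
      rw [List.replicate_succ, trimBlanks, List.foldr_cons]
      exact if_pos ⟨rfl, ih⟩
  | cons a l ih =>
    simp only [trimBlanks, List.cons_append, List.foldr_cons] at ih ⊢
    rw [ih]

/-- Half-tapes are classes of lists modulo trailing blanks; the trimmed list is a computable normal
form, so their equality can be tested. -/
theorem trimBlanks_eq_iff (l l' : List Γ) :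
    trimBlanks l = trimBlanks l' ↔ ListBlank.mk l = ListBlank.mk l' := by
  refine ⟨fun h => by rw [← mk_trimBlanks l, h, mk_trimBlanks], fun h => ?_⟩
  rcases Quotient.exact h with ⟨n, rfl⟩ | ⟨n, rfl⟩ <;> rw [trimBlanks_append]

theorem primrec_trimBlanks [Primcodable Γ] : Primrec (trimBlanks (Γ := Γ)) := by
  classical
  refine Primrec.list_foldr .id (.const []) (Primrec.to₂ (Primrec.ite (PrimrecPred.and
    (Primrec.eq.comp (Primrec.fst.comp .snd) (.const default))
    (Primrec.eq.comp (Primrec.snd.comp .snd) (.const [])))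
    (.const []) (Primrec.list_cons.comp (Primrec.fst.comp .snd) (Primrec.snd.comp .snd))))

/-- A tape given by the scanned symbol and the words to the left and to the right. -/
def codeTape (c : Γ × List Γ × List Γ) : Tape Γ :=
  ⟨c.1, ListBlank.mk c.2.1, ListBlank.mk c.2.2⟩

open Classical in
/-- The movement of a head on a coded tape. -/
noncomputable def codeMove (d : Option Turing.Dir) (c : Γ × List Γ × List Γ) :
    Γ × List Γ × List Γ :=
  if d = some .left then (c.2.1.headI, c.2.1.tail, c.1 :: c.2.2)
  else if d = some .right then (c.2.2.headI, c.1 :: c.2.1, c.2.2.tail)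
  else c

theorem codeTape_codeMove (d : Option Turing.Dir) (c : Γ × List Γ × List Γ) :
    codeTape (codeMove d c) = TuringMachine.moveHead d (codeTape c) := by
  rcases d with _ | _ | _
  · rfl
  · rfl
  · simp [codeMove, codeTape, TuringMachine.moveHead, Tape.move]

theorem primrec_codeMove [Primcodable Γ] [Primcodable Turing.Dir] :
    Primrec₂ (codeMove (Γ := Γ)) := by
  classical
  have h : Primrec fun p : Option Turing.Dir × Γ × List Γ × List Γ => p.2.1 :=
    Primrec.fst.comp .snd
  have l : Primrec fun p : Option Turing.Dir × Γ × List Γ × List Γ => p.2.2.1 :=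
    Primrec.fst.comp (Primrec.snd.comp .snd)
  have r : Primrec fun p : Option Turing.Dir × Γ × List Γ × List Γ => p.2.2.2 :=
    Primrec.snd.comp (Primrec.snd.comp .snd)
  refine Primrec.to₂ (Primrec.ite (Primrec.eq.comp .fst (.const _))
    (.pair (Primrec.list_headI.comp l) (.pair (Primrec.list_tail.comp l)
      (Primrec.list_cons.comp h r)))
    (Primrec.ite (Primrec.eq.comp .fst (.const _))
    (.pair (Primrec.list_headI.comp r) (.pair (Primrec.list_cons.comp h l)
      (Primrec.list_tail.comp r))) .snd))

theorem codeTape_eq_iff (c c' : Γ × List Γ × List Γ) : codeTape c = codeTape c' ↔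
    c.1 = c'.1 ∧ trimBlanks c.2.1 = trimBlanks c'.2.1 ∧ trimBlanks c.2.2 = trimBlanks c'.2.2 := by
  simp only [codeTape, Tape.mk.injEq, trimBlanks_eq_iff]

/-- The coded tape without trailing blanks. -/
noncomputable def trimTape (c : Γ × List Γ × List Γ) : Γ × List Γ × List Γ :=
  (c.1, trimBlanks c.2.1, trimBlanks c.2.2)

theorem trimTape_eq_iff (c c' : Γ × List Γ × List Γ) :
    trimTape c = trimTape c' ↔ codeTape c = codeTape c' := by
  simp only [codeTape_eq_iff, trimTape, Prod.mk.injEq]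

end

/-! ### Primitive recursive simulation of Turing machines -/

namespace TuringMachine

theorem stepN_eq_iterate (M : TuringMachine) (n : ℕ) (c : M.Cfg) :
    M.stepN n c = (fun o => Option.bind o M.step)^[n] (some c) := by
  have h : ∀ n, (fun o => Option.bind o M.step)^[n] none = none := by
    intro n
    induction n with
    | zero => rfl
    | succ n ih => rw [Function.iterate_succ_apply]; exact ih
  induction n generalizing c with
  | zero => rfl
  | succ n ih =>
    rw [stepN, Function.iterate_succ_apply]
    change _ = (fun o => Option.bind o M.step)^[n] (M.step c)
    rcases hc : M.step c with _ | d
    · rw [h]; rfl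
    · exact ih d

/-- Whether a Turing machine computes `v` from `u` in `n` steps is a primitive recursive
predicate. -/
theorem exists_primrec_computesIn (M : TuringMachine) : ∃ f : ℕ × ℕ × ℕ → Bool, Primrec f ∧
    ∀ n u v, f (n, u, v) = true ↔ M.ComputesIn n (numStr u) (numStr v) := by
  classical
  let _ := finitePrimcodable M.Q
  let _ := finitePrimcodable (TapeSymbol M.S)
  have : Finite Turing.Dir := Set.finite_univ_iff.1 ((Set.toFinite {.left, .right}).subset
    fun x _ => by cases x <;> simp)
  let _ := finitePrimcodable Turing.Dir
  obtain ⟨k, ⟨e⟩⟩ := Finite.exists_equiv_fin M.K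
  let Γ := TapeSymbol M.S
  let C := M.Q × (Fin k → Γ × List Γ × List Γ)
  let dec : C → M.Cfg := fun c => ⟨c.1, fun j => codeTape (c.2 (e j))⟩
  let δ : M.Q × (Fin k → Γ) → Option (M.Q × (Fin k → Γ × Option Turing.Dir)) := fun p =>
    (M.δ p.1 (fun j => p.2 (e j))).map fun a => (a.1, fun i => a.2 (e.symm i))
  let next : C → M.Q × (Fin k → Γ × Option Turing.Dir) → C := fun c a =>
    (a.1, fun i => codeMove (a.2 i).2 ((a.2 i).1, (c.2 i).2))
  let step : C → Option C := fun c => (δ (c.1, fun i => (c.2 i).1)).map (next c)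
  have app : ∀ {α σ : Type} [Primcodable α] [Primcodable σ] {f : α → Fin k → σ} (i : Fin k),
      Primrec f → Primrec fun a => f a i := fun i hf => Primrec.fin_app.comp hf (.const i)
  have hnext : Primrec₂ next := by
    refine Primrec.pair (Primrec.fst.comp .snd) (primrec_pi fun i => ?_)
    have h1 := app i (Primrec.snd.comp (Primrec.snd (α := C)
      (β := M.Q × (Fin k → Γ × Option Turing.Dir))))
    have h2 := app i (Primrec.snd.comp (Primrec.fst (α := C)
      (β := M.Q × (Fin k → Γ × Option Turing.Dir))))
    exact primrec_codeMove.comp (Primrec.snd.comp h1)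
      (.pair (Primrec.fst.comp h1) (Primrec.snd.comp h2))
  -- The transition table has a finite domain and is therefore primitive recursive, whatever it is.
  have hstep : Primrec step := by
    refine Primrec.option_map ((Primrec.dom_finite δ).comp (.pair .fst (primrec_pi fun i => ?_)))
      hnext
    exact Primrec.fst.comp (app i .snd)
  have dec_step : ∀ c, (step c).map dec = M.step (dec c) := by
    intro c
    simp only [step, δ, TuringMachine.step, Option.map_map]
    have : (fun j => (c.2 (e j)).1) = fun j => ((dec c).tape j).head := rfl
    rw [this]
    congr 1
    funext a
    simp only [Function.comp, dec, next, Cfg.mk.injEq, true_and]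
    funext j
    rw [codeTape_codeMove, Equiv.symm_apply_apply]
    rfl
  have dec_iter : ∀ n o, ((fun o => Option.bind o step)^[n] o).map dec =
      (fun o => Option.bind o M.step)^[n] (o.map dec) := by
    intro n
    induction n with
    | zero => intro o; rfl
    | succ n ih =>
      intro o
      rw [Function.iterate_succ_apply, Function.iterate_succ_apply, ih]
      congr 1
      rcases o with _ | c
      · rfl
      · exact dec_step c
  let tp : ℕ → Fin k → Γ × List Γ × List Γ := fun u i =>
    if e.symm i = M.io then (((numStr u).map fun b => some (Sum.inl b)).headI, [],
      ((numStr u).map fun b => some (Sum.inl b)).tail) else (none, [], [])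
  have htp : Primrec tp := by
    refine primrec_pi fun i => ?_
    by_cases hi : e.symm i = M.io
    · simp only [tp, if_pos hi]
      have : Primrec fun u => (numStr u).map fun b => (some (Sum.inl b) : Γ) :=
        Primrec.list_map primrec_numStr
          ((Primrec.dom_finite fun b : Bool => (some (Sum.inl b) : Γ)).comp Primrec.snd).to₂
      exact .pair (Primrec.list_headI.comp this) (.pair (.const _) (Primrec.list_tail.comp this))
    · simp only [tp, if_neg hi]
      exact .const _
  have dec_tp : ∀ q u, dec (q, tp u) = M.stdCfg q (numStr u) := by
    intro q u
    simp only [dec, stdCfg, Cfg.mk.injEq, true_and]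
    funext j
    simp only [tp, Equiv.symm_apply_apply]
    split_ifs
    · simp only [codeTape, Tape.mk₁, Tape.mk₂, Tape.mk', ListBlank.head_mk, ListBlank.tail_mk]
    · rfl
  -- Different codes may represent the same configuration, so the final configuration is recognised
  -- by comparing trimmed codes.
  let trim : C → C := fun c => (c.1, fun i => trimTape (c.2 i))
  have htrim : Primrec trim := by
    refine .pair .fst (primrec_pi fun i => ?_)
    have h := app i (Primrec.snd (α := M.Q) (β := Fin k → Γ × List Γ × List Γ))
    exact .pair (Primrec.fst.comp h) (.pair (primrec_trimBlanks.comp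
      (Primrec.fst.comp (Primrec.snd.comp h))) (primrec_trimBlanks.comp
      (Primrec.snd.comp (Primrec.snd.comp h))))
  have trim_eq : ∀ c c', trim c = trim c' ↔ dec c = dec c' := by
    intro c c'
    simp only [trim, dec, Cfg.mk.injEq]
    refine Prod.ext_iff.trans (and_congr_right fun _ => ?_)
    constructor
    · intro h
      funext j
      exact (trimTape_eq_iff _ _).1 (congrFun h (e j))
    · intro h
      funext i
      have := congrFun h (e.symm i)
      simp only [Equiv.apply_symm_apply] at this
      exact (trimTape_eq_iff _ _).2 this
  refine ⟨fun p => decide (((fun o => Option.bind o step)^[p.1] (some (M.start, tp p.2.1))).map trim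
    = some (trim (M.halt, tp p.2.2))), ?_, ?_⟩
  · refine PrimrecPred.decide (Primrec.eq.comp (Primrec.option_map ?_ (htrim.comp .snd).to₂)
      (Primrec.option_some.comp (htrim.comp (.pair (.const _)
        (htp.comp (Primrec.snd.comp .snd))))))
    exact Primrec.nat_iterate .fst (Primrec.option_some.comp (.pair (.const _)
        (htp.comp (Primrec.fst.comp .snd))))
      (Primrec.option_bind .snd (hstep.comp .snd).to₂).to₂
  · intro n u v
    simp only [decide_eq_true_eq, ComputesIn, stepN_eq_iterate]
    have := dec_iter n (some (M.start, tp u))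
    rw [Option.map_some, dec_tp] at this
    rw [← this, ← dec_tp, Option.map_eq_some_iff, Option.map_eq_some_iff]
    simp only [trim_eq]

end TuringMachine

end

/-! ## Universal reversible machines -/

section

open Turing (Tape ListBlank)
open Nat.Partrec (Code)

/-! ### Uniqueness of outputs and inputs; costs; partial recursiveness by search -/

namespace TuringMachine

theorem stepN_succ (M : TuringMachine) (n : ℕ) (c : M.Cfg) :
    M.stepN (n + 1) c = (M.stepN n c).bind M.step := by
  rw [stepN_eq_iterate, stepN_eq_iterate, Function.iterate_succ_apply']

theorem stdCfg_injective (M : TuringMachine) (q : M.Q) : Function.Injective (M.stdCfg q) := by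
  intro u v h
  have h1 := congrFun (show (M.stdCfg q u).tape = (M.stdCfg q v).tape by rw [h]) M.io
  simp only [stdCfg, if_true] at h1
  have h2 := congrArg Tape.right₀ h1
  simp only [Tape.mk₁, Tape.mk₂, Tape.mk'_right₀] at h2
  rw [← trimBlanks_eq_iff] at h2
  have h3 : ∀ u : List Bool, trimBlanks (u.map fun b => (some (Sum.inl b) : TapeSymbol M.S)) =
      u.map fun b => some (Sum.inl b) := by
    intro u
    induction u with
    | nil => rfl
    | cons b u ih =>
      simp only [trimBlanks, List.map_cons, List.foldr_cons] at ih ⊢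
      rw [if_neg, ih]
      rintro ⟨h, -⟩
      exact Option.some_ne_none _ h
  rw [h3, h3] at h2
  exact List.map_injective_iff.2 (fun a b h => by simpa using h) h2

theorem step_stdCfg_halt (M : TuringMachine) (v : List Bool) : M.step (M.stdCfg M.halt v) = none := by
  simp [step, stdCfg, M.δ_halt]

/-- Runs are deterministic, and a halting configuration has no successor, so neither run can
continue past the end of the other. -/
theorem ComputesIn.output_unique {M : TuringMachine} {n m : ℕ} {u v w : List Bool}
    (h : M.ComputesIn n u v) (h' : M.ComputesIn m u w) : v = w := by
  have key : ∀ n m (c : M.Cfg), M.stepN n c = some (M.stdCfg M.halt v) →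
      M.stepN m c = some (M.stdCfg M.halt w) → v = w := by
    intro n
    induction n with
    | zero =>
      intro m c h h'
      obtain rfl := Option.some.inj h
      rcases m with _ | m
      · exact M.stdCfg_injective _ (Option.some.inj h')
      · rw [stepN, step_stdCfg_halt] at h'
        cases h'
    | succ n ih =>
      intro m c h h'
      rcases m with _ | m
      · obtain rfl := Option.some.inj h'
        rw [stepN, step_stdCfg_halt] at h
        cases h
      · rw [stepN] at h h'
        rcases hc : M.step c with _ | d
        · simp [hc] at h
        · rw [hc] at h h'
          exact ih m d h h'
  exact key n m _ h h'

/-- The mirror image of `output_unique`: the two runs are traced back from the common end, and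
neither can pass a start configuration because it has no predecessor. -/
theorem IsReversible.input_unique {M : TuringMachine} (hM : M.IsReversible) {n m : ℕ}
    {u v w : List Bool} (h : M.ComputesIn n u w) (h' : M.ComputesIn m v w) : u = v := by
  have key : ∀ n m (d : M.Cfg), M.stepN n (M.stdCfg M.start u) = some d →
      M.stepN m (M.stdCfg M.start v) = some d → u = v := by
    have start_in : ∀ n c u, M.stepN (n + 1) c ≠ some (M.stdCfg M.start u) := by
      intro n c u h
      rw [stepN_succ, Option.bind_eq_some_iff] at h
      obtain ⟨d, -, hd⟩ := h
      exact hM.2 _ _ hd rfl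
    intro n
    induction n with
    | zero =>
      intro m d h h'
      obtain rfl := Option.some.inj h
      rcases m with _ | m
      · exact (M.stdCfg_injective _ (Option.some.inj h')).symm
      · exact absurd h' (start_in _ _ _)
    | succ n ih =>
      intro m d h h'
      rcases m with _ | m
      · obtain rfl := Option.some.inj h'
        exact absurd h (start_in _ _ _)
      · rw [stepN_succ, Option.bind_eq_some_iff] at h h'
        obtain ⟨c, hc, hd⟩ := h
        obtain ⟨c', hc', hd'⟩ := h'
        obtain rfl := hM.1 _ _ _ hd hd'
        exact ih m c hc hc'
  exact key n m _ h h'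

theorem cost_le_iff (R : TuringMachine) (x y : List Bool) (k : ℕ) : R.cost x y ≤ k ↔
    ∃ p q n, R.ComputesIn n (strPair x p) (strPair y q) ∧ p.length + q.length ≤ k := by
  rw [← ENat.lt_natCast_add_one_iff]
  simp only [cost, iInf_lt_iff, ENat.lt_natCast_add_one_iff, Nat.cast_le]
  constructor
  · rintro ⟨p, q, ⟨n, h⟩, hk⟩
    exact ⟨p, q, n, h, hk⟩
  · rintro ⟨p, q, n, h, hk⟩
    exact ⟨p, q, ⟨n, h⟩, hk⟩

theorem timedCost_le_iff (R : TuringMachine) (t : ℕ → ℕ) (x y : List Bool) (k : ℕ) :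
    R.timedCost t x y ≤ k ↔ ∃ p q, ∃ n ≤ t x.length,
      R.ComputesIn n (strPair x p) (strPair y q) ∧ p.length + q.length ≤ k := by
  rw [← ENat.lt_natCast_add_one_iff]
  simp only [timedCost, iInf_lt_iff, ENat.lt_natCast_add_one_iff, Nat.cast_le]
  constructor
  · rintro ⟨p, q, ⟨n, hn, h⟩, hk⟩
    exact ⟨p, q, n, hn, h, hk⟩
  · rintro ⟨p, q, n, hn, h, hk⟩
    exact ⟨p, q, ⟨n, hn, h⟩, hk⟩

/-- The search runs over pairs of a step number and a candidate. It may stop at another pair than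
the given one, but the uniqueness hypothesis forces the same candidate. -/
theorem exists_partrec_search {c : ℕ × ℕ → Bool} (hc : Computable c) : ∃ f : ℕ →. ℕ, Partrec f ∧
    ∀ u n v, c (u, Nat.pair n v) = true → (∀ m w, c (u, Nat.pair m w) = true → w = v) →
      v ∈ f u := by
  refine ⟨fun u => (Nat.rfind fun w => Part.some (c (u, w))).map fun w => w.unpair.2, ?_,
    fun u n v h hu => ?_⟩
  · have h1 : Partrec₂ fun u w : ℕ => (Part.some (c (u, w)) : Part Bool) := hc.partrec
    have h2 : Computable fun p : ℕ × ℕ => p.2.unpair.2 :=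
      Computable.snd.comp (Computable.unpair.comp .snd)
    exact Partrec.map (Partrec.rfind h1) h2
  · have hdom : (Nat.rfind fun w => Part.some (c (u, w))).Dom :=
      Nat.rfind_dom.2 ⟨Nat.pair n v, by simp [h], fun _ => trivial⟩
    obtain ⟨w, hw⟩ := Part.dom_iff_mem.1 hdom
    have hw' := Nat.rfind_spec hw
    simp only [Part.mem_some_iff] at hw'
    refine (Part.mem_map_iff _).2 ⟨w, hw, hu w.unpair.1 _ ?_⟩
    rw [Nat.pair_unpair, ← hw']

/-- A Turing machine computes a partial recursive function. -/
theorem exists_partrec_computes (M : TuringMachine) : ∃ f : ℕ →. ℕ, Partrec f ∧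
    ∀ n u v, M.ComputesIn n u v → strNum v ∈ f (strNum u) := by
  obtain ⟨c, hc, hM⟩ := M.exists_primrec_computesIn
  have hp : Primrec fun p : ℕ × ℕ => (p.2.unpair.1, p.1, p.2.unpair.2) :=
    .pair (Primrec.fst.comp (Primrec.unpair.comp .snd))
      (.pair .fst (Primrec.snd.comp (Primrec.unpair.comp .snd)))
  obtain ⟨f, hf, h⟩ := exists_partrec_search (hc.comp hp).to_comp
  refine ⟨f, hf, fun n u v huv => h _ n _ ?_ fun m w hw => ?_⟩
  · simpa [hM, numStr_strNum] using huv
  · simp only [Nat.unpair_pair, hM, numStr_strNum] at hw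
    rw [huv.output_unique hw, strNum_numStr]

/-- The inverse of the function computed by a reversible machine is partial recursive. -/
theorem IsReversible.exists_partrec_inverse {M : TuringMachine} (hr : M.IsReversible) :
    ∃ f : ℕ →. ℕ, Partrec f ∧ ∀ n u v, M.ComputesIn n u v → strNum u ∈ f (strNum v) := by
  obtain ⟨c, hc, hM⟩ := M.exists_primrec_computesIn
  have hp : Primrec fun p : ℕ × ℕ => (p.2.unpair.1, p.2.unpair.2, p.1) :=
    .pair (Primrec.fst.comp (Primrec.unpair.comp .snd))
      (.pair (Primrec.snd.comp (Primrec.unpair.comp .snd)) .fst)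
  obtain ⟨f, hf, h⟩ := exists_partrec_search (hc.comp hp).to_comp
  refine ⟨f, hf, fun n u v huv => h _ n _ ?_ fun m w hw => ?_⟩
  · simpa [hM, numStr_strNum] using huv
  · simp only [Nat.unpair_pair, hM, numStr_strNum] at hw
    rw [hr.input_unique huv hw, strNum_numStr]

end TuringMachine

/-! ### Splitting off the power of two -/

/-- The exponent `e` and the number `k` with `n = 2 ^ e * (2 * k + 1)`. -/
def splitPow (n : ℕ) : ℕ × ℕ :=
  let p := (fun p : ℕ × ℕ => if p.2 % 2 = 0 then (p.1 + 1, p.2 / 2) else p)^[n] (0, n)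
  (p.1, p.2 / 2)

/-- Halving stops at the odd part, which is a fixed point, and n rounds suffice because the exponent
of 2 in n is at most n. -/
theorem splitPow_eq (e k : ℕ) : splitPow (2 ^ e * (2 * k + 1)) = (e, k) := by
  have odd : ∀ j a, (fun p : ℕ × ℕ => if p.2 % 2 = 0 then (p.1 + 1, p.2 / 2) else p)^[j]
      (a, 2 * k + 1) = (a, 2 * k + 1) := by
    intro j a
    refine Function.iterate_fixed ?_ j
    simp only
    rw [if_neg (by omega)]
  have key : ∀ e j a, e ≤ j → (fun p : ℕ × ℕ => if p.2 % 2 = 0 then (p.1 + 1, p.2 / 2) else p)^[j]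
      (a, 2 ^ e * (2 * k + 1)) = (a + e, 2 * k + 1) := by
    intro e
    induction e with
    | zero => intro j a _; simpa using odd j a
    | succ e ih =>
      intro j a hj
      obtain ⟨j, rfl⟩ : ∃ i, j = i + 1 := ⟨j - 1, by omega⟩
      have h : 2 ^ (e + 1) * (2 * k + 1) = 2 * (2 ^ e * (2 * k + 1)) := by ring
      rw [Function.iterate_succ_apply, h]
      simp only [Nat.mul_mod_right, if_true, Nat.mul_div_cancel_left _ (Nat.succ_pos 1)]
      rw [ih _ _ (by omega), Nat.add_right_comm, Nat.add_assoc]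
  have he : e ≤ 2 ^ e * (2 * k + 1) :=
    e.lt_two_pow_self.le.trans (Nat.le_mul_of_pos_right _ (by omega))
  simp only [splitPow, key e _ 0 he]
  refine Prod.ext (by simp) (by simp only; omega)

theorem primrec_splitPow : Primrec splitPow := by
  have h : Primrec fun n : ℕ =>
      (fun p : ℕ × ℕ => if p.2 % 2 = 0 then (p.1 + 1, p.2 / 2) else p)^[n] (0, n) :=
    Primrec.nat_iterate .id (.pair (.const 0) .id) (Primrec.ite
      (Primrec.eq.comp (Primrec.nat_mod.comp (Primrec.snd.comp .snd) (.const 2)) (.const 0))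
      (.pair (Primrec.succ.comp (Primrec.fst.comp .snd))
        (Primrec.nat_div.comp (Primrec.snd.comp .snd) (.const 2))) .snd).to₂
  exact .pair (Primrec.fst.comp h) (Primrec.nat_div.comp (Primrec.snd.comp h) (.const 2))

theorem primrec_two_pow : Primrec fun n : ℕ => 2 ^ n :=
  (Primrec.nat_rec₁ 1 (Primrec.nat_mul.comp (.const 2) .snd).to₂).of_eq fun n => by
    induction n with
    | zero => rfl
    | succ n ih => simp only [ih, pow_succ']

/-- The number of the string that carries the program `e` and the string with number `k`. -/
def withProgram (e k : ℕ) : ℕ := 2 ^ e * (2 * k + 1) - 1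

theorem splitPow_withProgram (e k : ℕ) : splitPow (withProgram e k + 1) = (e, k) := by
  have : 0 < 2 ^ e * (2 * k + 1) := by positivity
  rw [withProgram, Nat.sub_add_cancel this, splitPow_eq]

theorem primrec_withProgram : Primrec₂ withProgram :=
  (Primrec.pred.comp (Primrec.nat_mul.comp (primrec_two_pow.comp .fst)
    (Primrec.succ.comp (Primrec.nat_mul.comp (.const 2) .snd)))).to₂

theorem length_numStr (n : ℕ) : (numStr n).length = Nat.log 2 (n + 1) := by
  induction n using Nat.strong_induction_on with
  | _ n ih =>
    rcases n with _ | n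
    · simp [numStr]
    · have h : Nat.log 2 (n + 1 + 1) = Nat.log 2 ((n + 1 + 1) / 2) + 1 :=
        Nat.log_of_one_lt_of_le (by simp) (by omega)
      have h' : (n + 1 + 1) / 2 = n / 2 + 1 := by omega
      rw [numStr, List.length_append, ih _ (by omega), h, h', List.length_singleton]

theorem log_two_mul_pow (n : ℕ) (hn : n ≠ 0) (e : ℕ) : Nat.log 2 (n * 2 ^ e) = Nat.log 2 n + e := by
  induction e with
  | zero => simp
  | succ e ih =>
    rw [pow_succ, ← mul_assoc, Nat.log_mul_base (by simp) (by positivity), ih, add_assoc]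

/-- The reason for coding by 2 ^ e (2 k + 1): attaching a program adds a constant to the length of
the string, which `Nat.pair` would roughly double for large k. -/
theorem length_numStr_withProgram_le (e : ℕ) (p : List Bool) :
    (numStr (withProgram e (strNum p))).length ≤ p.length + (e + 1) := by
  have hp : p.length = Nat.log 2 (strNum p + 1) := by
    rw [← length_numStr, numStr_strNum]
  have : 0 < 2 ^ e * (2 * strNum p + 1) := by positivity
  rw [length_numStr, hp, withProgram, Nat.sub_add_cancel this]
  calc Nat.log 2 (2 ^ e * (2 * strNum p + 1))
      ≤ Nat.log 2 ((strNum p + 1) * 2 ^ (e + 1)) := by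
        refine Nat.log_mono_right ?_
        rw [pow_succ]
        nlinarith [Nat.two_pow_pos e]
    _ = Nat.log 2 (strNum p + 1) + (e + 1) :=
        by rw [← log_two_mul_pow _ (by omega)]

/-! ### The universal function and its reversible machine -/

/-- The function computed by a universal machine, `s` selects one of two programs. -/
def universalFun (s : ℕ → ℕ) (a : ℕ) : Part ℕ :=
  ((Denumerable.ofNat Code (s (splitPow (a.unpair.2 + 1)).1)).eval
    (Nat.pair a.unpair.1 (splitPow (a.unpair.2 + 1)).2)).map fun b =>
      Nat.pair b.unpair.1 (withProgram (splitPow (a.unpair.2 + 1)).1 b.unpair.2)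

theorem partrec_universalFun {s : ℕ → ℕ} (hs : Primrec s) : Partrec (universalFun s) := by
  have h : Primrec fun a : ℕ => splitPow (a.unpair.2 + 1) :=
    primrec_splitPow.comp (Primrec.succ.comp (Primrec.snd.comp Primrec.unpair))
  refine Partrec.map (Code.eval_part.comp ((Primrec.ofNat Code).comp
    (hs.comp (Primrec.fst.comp h))).to_comp (Primrec₂.natPair.comp
      (Primrec.fst.comp Primrec.unpair) (Primrec.snd.comp h)).to_comp) ?_
  exact (Primrec₂.natPair.comp (Primrec.fst.comp (Primrec.unpair.comp .snd))
    (primrec_withProgram.comp (Primrec.fst.comp (h.comp .fst))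
      (Primrec.snd.comp (Primrec.unpair.comp .snd)))).to_comp.to₂

/-- The program number e survives in the output. Hence the same function, with `s` selecting the
program of the inverse, undoes the computation. -/
theorem mem_universalFun {s : ℕ → ℕ} {e x p y q : ℕ} {c : Code} (hc : s e = Encodable.encode c)
    (h : Nat.pair y q ∈ c.eval (Nat.pair x p)) :
    Nat.pair y (withProgram e q) ∈ universalFun s (Nat.pair x (withProgram e p)) := by
  simp only [universalFun, Nat.unpair_pair, splitPow_withProgram, hc, Denumerable.ofNat_encode]
  rw [Part.mem_map_iff]
  exact ⟨_, h, by simp⟩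

theorem strNum_strPair (x p : List Bool) : strNum (strPair x p) = Nat.pair (strNum x) (strNum p) :=
  strEquiv.apply_symm_apply _

/-- Universal reversible Turing machines exist. -/
theorem TuringMachine.exists_isUniversalReversible :
    ∃ U : TuringMachine, U.IsUniversalReversible := by
  obtain ⟨U, hU, hUc⟩ := RevMachine.exists_reversible_of_partrec
    (partrec_universalFun (Primrec.fst.comp Primrec.unpair))
    (partrec_universalFun (Primrec.snd.comp Primrec.unpair))
  refine ⟨U, hU, fun R hR => ?_⟩
  obtain ⟨f, hf, hfR⟩ := R.exists_partrec_computes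
  obtain ⟨g, hg, hgR⟩ := hR.exists_partrec_inverse
  obtain ⟨cf, rfl⟩ := Code.exists_code.1 (Partrec.nat_iff.1 hf)
  obtain ⟨cg, rfl⟩ := Code.exists_code.1 (Partrec.nat_iff.1 hg)
  set e := Nat.pair (Encodable.encode cf) (Encodable.encode cg) with he
  -- The program is carried once in the input and once in the output, at e + 1 bits each.
  refine ⟨2 * (e + 1), fun x y => ?_⟩
  rcases hk : R.cost x y with _ | k
  · exact le_top.trans_eq (top_add _).symm
  obtain ⟨p, q, n, h, hpq⟩ := (R.cost_le_iff x y k).1 hk.le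
  have hf' := hfR _ _ _ h
  have hg' := hgR _ _ _ h
  rw [strNum_strPair, strNum_strPair] at hf' hg'
  obtain ⟨m, hm⟩ := hUc (strPair x (numStr (withProgram e (strNum p))))
    (strPair y (numStr (withProgram e (strNum q))))
    (by
      rw [strNum_strPair, strNum_strPair, strNum_numStr, strNum_numStr]
      exact mem_universalFun (by simp [he]) hf')
    (by
      rw [strNum_strPair, strNum_strPair, strNum_numStr, strNum_numStr]
      exact mem_universalFun (by simp [he]) hg')
  have hle : U.cost x y ≤ (k + 2 * (e + 1) : ℕ) := by
    refine (U.cost_le_iff _ _ _).2 ⟨_, _, m, hm, ?_⟩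
    have h1 := length_numStr_withProgram_le e p
    have h2 := length_numStr_withProgram_le e q
    omega
  exact_mod_cast hle

end

/-! ## A recursively enumerable sequence that avoids all short computable lists -/

section

open Nat.Partrec (Code)

/-- The `j`-th position of the block with the numbers `e` and `k`, which has length `2 ^ k`. -/
def blockPos (e k j : ℕ) : ℕ := 2 ^ e * (2 * (2 ^ k + j) + 1)

/-- Keeps position 1 out of all blocks, so that the first bit can be prescribed. -/
theorem three_le_blockPos (e k j : ℕ) : 3 ≤ blockPos e k j := by
  have h1 := Nat.two_pow_pos e
  have h2 := Nat.two_pow_pos k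
  unfold blockPos
  nlinarith

theorem blockPos_lt {e k j : ℕ} (hj : j < 2 ^ k) : blockPos e k j < 2 ^ (e + k + 2) := by
  have h : 2 ^ (e + k + 2) = 2 ^ e * (4 * 2 ^ k) := by ring
  rw [blockPos, h]
  exact Nat.mul_lt_mul_of_pos_left (by omega) (Nat.two_pow_pos e)

/-- The part of a string at the positions of a block (counted from 1). -/
def block (e k : ℕ) (x : List Bool) : List Bool :=
  (List.range (2 ^ k)).map fun j => x.getD (blockPos e k j - 1) false

theorem initialSegment_getD (χ : ℕ → Bool) {n i : ℕ} (h : 1 ≤ i) (hi : i ≤ n) :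
    (initialSegment χ n).getD (i - 1) false = χ i := by
  rw [List.getD_eq_getElem _ _ (by simp [initialSegment]; omega)]
  simp [initialSegment, Nat.sub_add_cancel h]

theorem exists_length_eq_not_mem (L : ℕ) (l : List ℕ) (hl : l.length < 2 ^ L) :
    ∃ w, (numStr w).length = L ∧ w ∉ l := by
  by_contra! h
  -- The strings of length L have the 2 ^ L consecutive numbers from 2 ^ L - 1 on.
  have hsub : Finset.Ico (2 ^ L - 1) (2 ^ (L + 1) - 1) ⊆ l.toFinset := by
    intro w hw
    rw [Finset.mem_Ico] at hw
    rw [List.mem_toFinset]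
    have := Nat.two_pow_pos L
    refine h w ?_
    rw [length_numStr]
    exact Nat.log_eq_of_pow_le_of_lt_pow (by omega) (by omega)
  have h1 := (Finset.card_le_card hsub).trans (List.toFinset_card_le l)
  rw [Nat.card_Ico, pow_succ] at h1
  have := Nat.two_pow_pos L
  omega

/-- The least string of length `2 ^ k` that is not in the list computed by the program `e`
for the block with the numbers `e` and `k`. -/
def avoiding (p : ℕ × ℕ) : Part ℕ :=
  ((Denumerable.ofNat Code p.1).eval (Nat.pair p.1 p.2)).bind fun n =>
    Nat.rfind fun w => Part.some (decide ((numStr w).length = 2 ^ p.2) &&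
      decide (((Encodable.decode (α := List ℕ) n).getD []).idxOf w =
        ((Encodable.decode (α := List ℕ) n).getD []).length))

theorem partrec_avoiding : Partrec avoiding := by
  have h1 : Primrec fun p : ((ℕ × ℕ) × ℕ) × ℕ =>
      ((Encodable.decode (α := List ℕ) p.1.2).getD []) :=
    Primrec.option_getD.comp (Primrec.decode.comp (Primrec.snd.comp .fst)) (.const [])
  have h2 : Primrec fun p : ((ℕ × ℕ) × ℕ) × ℕ => decide ((numStr p.2).length = 2 ^ p.1.1.2) :=
    PrimrecPred.decide (Primrec.eq.comp (Primrec.list_length.comp (primrec_numStr.comp .snd))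
      (primrec_two_pow.comp (Primrec.snd.comp (Primrec.fst.comp .fst))))
  have h3 : Primrec fun p : ((ℕ × ℕ) × ℕ) × ℕ =>
      decide (((Encodable.decode (α := List ℕ) p.1.2).getD []).idxOf p.2 =
        ((Encodable.decode (α := List ℕ) p.1.2).getD []).length) :=
    PrimrecPred.decide (Primrec.eq.comp (Primrec.list_idxOf.comp .snd h1)
      (Primrec.list_length.comp h1))
  have h4 : Partrec₂ fun (p : (ℕ × ℕ) × ℕ) (w : ℕ) =>
      (Part.some (decide ((numStr w).length = 2 ^ p.1.2) &&
        decide (((Encodable.decode (α := List ℕ) p.2).getD []).idxOf w =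
          ((Encodable.decode (α := List ℕ) p.2).getD []).length)) : Part Bool) :=
    (Primrec.and.comp h2 h3).to_comp.partrec
  have h5 : Partrec₂ fun (p : ℕ × ℕ) (n : ℕ) =>
      Nat.rfind fun w => Part.some (decide ((numStr w).length = 2 ^ p.2) &&
        decide (((Encodable.decode (α := List ℕ) n).getD []).idxOf w =
          ((Encodable.decode (α := List ℕ) n).getD []).length)) := Partrec.rfind h4
  exact Partrec.bind (Code.eval_part.comp ((Primrec.ofNat Code).comp .fst).to_comp
    (Primrec₂.natPair.comp .fst .snd).to_comp) h5

/-- There are more words of length 2 ^ k than list entries, so the search in `avoiding` ends.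
Nonmembership is tested there in the form `idxOf w = length`. -/
theorem exists_mem_avoiding {e k : ℕ} {l : List ℕ} (hl : l.length < 2 ^ 2 ^ k)
    (he : Encodable.encode l ∈ (Denumerable.ofNat Code e).eval (Nat.pair e k)) :
    ∃ w ∈ avoiding (e, k), (numStr w).length = 2 ^ k ∧ w ∉ l := by
  have hl' : ∀ w, l.idxOf w = l.length ↔ w ∉ l := fun w => List.idxOf_eq_length_iff
  obtain ⟨v, hv, hvl⟩ := exists_length_eq_not_mem _ l hl
  have hdom : (Nat.rfind fun w => Part.some (decide ((numStr w).length = 2 ^ k) &&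
      decide (((Encodable.decode (α := List ℕ) (Encodable.encode l)).getD []).idxOf w =
        ((Encodable.decode (α := List ℕ) (Encodable.encode l)).getD []).length))).Dom :=
    Nat.rfind_dom.2 ⟨v, by simp [hv, hvl], fun _ => trivial⟩
  obtain ⟨w, hw⟩ := Part.dom_iff_mem.1 hdom
  refine ⟨w, Part.mem_bind_iff.2 ⟨_, he, hw⟩, ?_⟩
  have := Nat.rfind_spec hw
  simp only [Encodable.encodek, Option.getD_some, hl', Part.mem_some_iff, eq_comm (a := true),
    Bool.and_eq_true, decide_eq_true_eq] at this
  exact this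

/-- There is an r.e. sequence with a given first bit that avoids all short computable lists of
blocks. -/
theorem exists_isRESequence_avoiding (b : Bool) : ∃ χ : ℕ → Bool, IsRESequence χ ∧ χ 1 = b ∧
    ∀ F : ℕ → ℕ → List ℕ, Computable₂ F → (∀ e k, (F e k).length < 2 ^ 2 ^ k) →
      ∃ e, ∀ k n, 2 ^ (e + k + 2) ≤ n → strNum (block e k (initialSegment χ n)) ∉ F e k := by
  classical
  -- The odd part of a block position yields 2 ^ k + j with j < 2 ^ k, and the string numbered 2 ^ k
  -- + j - 1 has length k.
  let lg : ℕ → ℕ := fun i => (numStr ((splitPow i).2 - 1)).length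
  -- The semidecision procedure for χ: position 1 follows b; any other position waits for the
  -- avoiding word of its block and is accepted if its bit there is 1.
  let f : ℕ →. Unit := fun i => bif decide (i = 1) then (bif b then Part.some () else Part.none)
    else (avoiding ((splitPow i).1, lg i)).bind fun w =>
      bif (numStr w).getD ((splitPow i).2 - 2 ^ lg i) false then Part.some () else Part.none
  have hlg : Primrec lg := Primrec.list_length.comp (primrec_numStr.comp
    (Primrec.pred.comp (Primrec.snd.comp primrec_splitPow)))
  have hf : Partrec f := by
    refine Partrec.cond (PrimrecPred.decide (Primrec.eq.comp .id (.const 1))).to_comp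
      (Partrec.cond (Computable.const b) (Computable.const ()).partrec Partrec.none) ?_
    refine Partrec.bind (partrec_avoiding.comp
      (Primrec.pair (Primrec.fst.comp primrec_splitPow) hlg).to_comp) ?_
    have h1 : Computable fun p : ℕ × ℕ =>
        (numStr p.2).getD ((splitPow p.1).2 - 2 ^ lg p.1) false := ((Primrec.list_getD false).comp (primrec_numStr.comp .snd) (Primrec.nat_sub.comp
      (Primrec.snd.comp (primrec_splitPow.comp .fst))
      (primrec_two_pow.comp (hlg.comp .fst)))).to_comp
    exact (Partrec.cond h1 (Computable.const ()).partrec Partrec.none).to₂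
  refine ⟨fun i => decide (f i).Dom, ⟨{i | (f i).Dom}, hf.dom_re, fun i _ => by simp⟩, ?_, ?_⟩
  · cases b <;> simp [f]
  · intro F hF hlen
    obtain ⟨c, hc⟩ := Code.exists_code.1 (Partrec.nat_iff.1 (Computable.partrec
      (Computable.encode.comp (hF.comp (Computable.fst.comp .unpair)
        (Computable.snd.comp .unpair)))))
    -- The required e is the index of a program for F itself, since program e is what the blocks (e,
    -- k) diagonalize against.
    refine ⟨Encodable.encode c, fun k n hn => ?_⟩
    set e := Encodable.encode c with he
    obtain ⟨w, hw, hwl, hwF⟩ := exists_mem_avoiding (e := e) (k := k) (hlen e k) (by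
      rw [he, Denumerable.ofNat_encode, hc]
      simp)
    have hblock : block e k (initialSegment (fun i => decide (f i).Dom) n) = numStr w := by
      refine List.ext_getElem (by simp [block, hwl]) fun j h1 h2 => ?_
      have hj : j < 2 ^ k := by simpa [block] using h1
      have hpos := three_le_blockPos e k j
      simp only [block, List.getElem_map, List.getElem_range]
      rw [initialSegment_getD _ (by omega) ((blockPos_lt hj).le.trans hn)]
      have hs : splitPow (blockPos e k j) = (e, 2 ^ k + j) := splitPow_eq _ _
      have hk : lg (blockPos e k j) = k := by
        have := Nat.two_pow_pos k
        simp only [lg, hs, length_numStr]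
        rw [Nat.sub_add_cancel (by omega)]
        exact Nat.log_eq_of_pow_le_of_lt_pow (by omega) (by rw [pow_succ]; omega)
      have hne : ¬ blockPos e k j = 1 := by omega
      have hfi : f (blockPos e k j) =
          bif (numStr w).getD j false then Part.some () else Part.none := by
        simp only [f, hs, hk, hne, decide_false, cond_false, Part.eq_some_iff.2 hw,
          Part.bind_some, Nat.add_sub_cancel_left]
      rw [hfi, List.getD_eq_getElem _ _ h2]
      cases (numStr w)[j] <;> simp
    rw [hblock, strNum_numStr]
    exact hwF

end

/-! ## The lower bound for computable time bounds -/

section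

theorem Computable.range_map {α σ : Type} [Primcodable α] [Primcodable σ] {f : α → ℕ → σ}
    {N : α → ℕ} (hf : Computable₂ f) (hN : Computable N) :
    Computable fun a => (List.range (N a)).map (f a) := by
  have h : Computable₂ fun (a : α) (p : ℕ × List σ) => p.2 ++ [f a p.1] :=
    Computable.list_concat.comp (Computable.snd.comp .snd)
      (hf.comp .fst (Computable.fst.comp .snd))
  refine (Computable.nat_rec hN (Computable.const []) h).of_eq fun a => ?_
  induction N a with
  | zero => rfl
  | succ n ih => simp only [ih, List.range_succ, List.map_append, List.map_cons, List.map_nil]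

theorem primrec_block : Primrec fun p : (ℕ × ℕ) × List Bool => block p.1.1 p.1.2 p.2 := by
  have h1 : Primrec fun p : ((ℕ × ℕ) × List Bool) × ℕ => blockPos p.1.1.1 p.1.1.2 p.2 :=
    Primrec.nat_mul.comp (primrec_two_pow.comp (Primrec.fst.comp (Primrec.fst.comp .fst)))
      (Primrec.succ.comp (Primrec.nat_mul.comp (.const 2) (Primrec.nat_add.comp
        (primrec_two_pow.comp (Primrec.snd.comp (Primrec.fst.comp .fst))) .snd)))
  have h2 : Primrec₂ fun (p : (ℕ × ℕ) × List Bool) (j : ℕ) =>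
      p.2.getD (blockPos p.1.1 p.1.2 j - 1) false :=
    (Primrec.list_getD false).comp (Primrec.snd.comp .fst) (Primrec.pred.comp h1)
  exact Primrec.list_map (Primrec.list_range.comp
    (primrec_two_pow.comp (Primrec.snd.comp .fst))) h2

theorem computable_block_list {G : ℕ → List Bool} (hG : Computable G) :
    Computable₂ fun e k : ℕ => (List.range (2 ^ 2 ^ k - 1)).map fun s =>
      strNum (block e k (G s)) := by
  have h1 : Computable fun p : (ℕ × ℕ) × List Bool => strNum (block p.1.1 p.1.2 p.2) :=
    (primrec_strNum.comp primrec_block).to_comp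
  have h2 : Computable fun p : (ℕ × ℕ) × ℕ => (p.1, G p.2) :=
    Computable.pair .fst (hG.comp .snd)
  have h3 : Computable₂ fun (a : ℕ × ℕ) (s : ℕ) => strNum (block a.1 a.2 (G s)) :=
    Computable.comp (f := fun p : (ℕ × ℕ) × List Bool => strNum (block p.1.1 p.1.2 p.2))
      (g := fun p : (ℕ × ℕ) × ℕ => (p.1, G p.2)) h1 h2
  have h4 : Primrec fun a : ℕ × ℕ => 2 ^ 2 ^ a.2 - 1 :=
    Primrec.pred.comp (primrec_two_pow.comp (primrec_two_pow.comp .snd))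
  exact Computable.range_map (f := fun (a : ℕ × ℕ) (s : ℕ) => strNum (block a.1 a.2 (G s)))
    (N := fun a : ℕ × ℕ => 2 ^ 2 ^ a.2 - 1) h3 h4.to_comp

theorem strNum_lt (q : List Bool) : strNum q + 1 < 2 ^ (q.length + 1) := by
  have h := length_numStr (strNum q)
  rw [numStr_strNum] at h
  rw [h]
  exact Nat.lt_pow_succ_log_self (by simp) _

namespace TuringMachine

/-- From the length of `x` and the string `q`, the string `x` with `M(⟨x, p⟩) = ⟨ε, q⟩` is found
by a computable search. -/
theorem IsReversible.exists_primrec_decoder {M : TuringMachine} (hM : M.IsReversible) :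
    ∃ D : ℕ × ℕ × ℕ → List Bool, Primrec D ∧ ∀ (x p q : List Bool) (s T : ℕ),
      M.ComputesIn s (strPair x p) (strPair [] q) → s ≤ T → p.length ≤ x.length →
        D (x.length, strNum q, T) = x := by
  classical
  obtain ⟨c, hc, hcM⟩ := M.exists_primrec_computesIn
  -- A candidate w codes an input together with a step number. As |x| and a bound for |p| and the
  -- time are known, candidates are bounded by `B`.
  let P : ℕ × ℕ × ℕ → ℕ → Prop := fun a w => (numStr w.unpair.1.unpair.1).length = a.1 ∧
    w.unpair.2 ≤ a.2.2 ∧ c (w.unpair.2, w.unpair.1, Nat.pair 0 a.2.1) = true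
  let B : ℕ × ℕ × ℕ → ℕ := fun a => Nat.pair (Nat.pair (2 ^ (a.1 + 1)) (2 ^ (a.1 + 1))) a.2.2
  have hB : Primrec B := by
    have : Primrec fun a : ℕ × ℕ × ℕ => 2 ^ (a.1 + 1) :=
      primrec_two_pow.comp (Primrec.succ.comp .fst)
    exact Primrec₂.natPair.comp (Primrec₂.natPair.comp this this) (Primrec.snd.comp .snd)
  have hu : Primrec fun p : (ℕ × ℕ × ℕ) × ℕ => p.2.unpair.1 :=
    Primrec.fst.comp (Primrec.unpair.comp .snd)
  have hs : Primrec fun p : (ℕ × ℕ × ℕ) × ℕ => p.2.unpair.2 :=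
    Primrec.snd.comp (Primrec.unpair.comp .snd)
  have hP : PrimrecRel P := by
    have h1 : PrimrecPred fun p : (ℕ × ℕ × ℕ) × ℕ =>
        (numStr p.2.unpair.1.unpair.1).length = p.1.1 :=
      Primrec.eq.comp (Primrec.list_length.comp (primrec_numStr.comp
        (Primrec.fst.comp (Primrec.unpair.comp hu)))) (Primrec.fst.comp .fst)
    have h2 : PrimrecPred fun p : (ℕ × ℕ × ℕ) × ℕ => p.2.unpair.2 ≤ p.1.2.2 :=
      Primrec.nat_le.comp hs (Primrec.snd.comp (Primrec.snd.comp .fst))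
    have h3 : PrimrecPred fun p : (ℕ × ℕ × ℕ) × ℕ =>
        c (p.2.unpair.2, p.2.unpair.1, Nat.pair 0 p.1.2.1) = true :=
      Primrec.eq.comp (hc.comp (.pair hs (.pair hu (Primrec₂.natPair.comp (.const 0)
        (Primrec.fst.comp (Primrec.snd.comp .fst)))))) (.const true)
    exact h1.and (h2.and h3)
  refine ⟨fun a => numStr (Nat.findGreatest (P a) (B a)).unpair.1.unpair.1, ?_, ?_⟩
  · exact primrec_numStr.comp (Primrec.fst.comp (Primrec.unpair.comp (Primrec.fst.comp
      (Primrec.unpair.comp (Primrec.nat_findGreatest hB hP)))))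
  · intro x p q s T h hsT hpx
    have hv : numStr (Nat.pair 0 (strNum q)) = strPair [] q := rfl
    have hw : P (x.length, strNum q, T) (Nat.pair (strNum (strPair x p)) s) := by
      refine ⟨?_, ?_, ?_⟩
      · simp [strNum_strPair, numStr_strNum]
      · simpa using hsT
      · simp only [Nat.unpair_pair]
        rw [hcM, hv, numStr_strNum]
        exact h
    have hle : Nat.pair (strNum (strPair x p)) s ≤ B (x.length, strNum q, T) := by
      have h1 := strNum_lt x
      have h2 := (strNum_lt p).trans_le (Nat.pow_le_pow_right (n := 2) (by simp)
        (Nat.add_le_add_right hpx 1))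
      have mono : ∀ {a a' b b' : ℕ}, a ≤ a' → b ≤ b' → Nat.pair a b ≤ Nat.pair a' b' := by
        intro a a' b b' ha hb
        have h1 : Nat.pair a b ≤ Nat.pair a' b := ha.lt_or_eq.elim
          (fun h => (Nat.pair_lt_pair_left b h).le) fun h => h ▸ le_rfl
        have h2 : Nat.pair a' b ≤ Nat.pair a' b' := hb.lt_or_eq.elim
          (fun h => (Nat.pair_lt_pair_right a' h).le) fun h => h ▸ le_rfl
        exact h1.trans h2
      rw [strNum_strPair]
      change _ ≤ Nat.pair (Nat.pair (2 ^ (x.length + 1)) (2 ^ (x.length + 1))) T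
      exact mono (mono (by omega) (by omega)) hsT
    -- The search may find another step number, but reversibility leaves only one possible input.
    obtain ⟨-, -, h3⟩ := Nat.findGreatest_spec hle hw
    rw [hcM, hv] at h3
    have := congrArg strNum (hM.input_unique h h3)
    rw [strNum_strPair, strNum_numStr] at this
    simp only [← this, Nat.unpair_pair, numStr_strNum]

/-- If the sequence `χ` avoids all short computable lists, then initial segments can be erased in
computable time only at linear cost. -/
theorem IsReversible.exists_linear_lower_bound {M : TuringMachine} (hM : M.IsReversible)
    {χ : ℕ → Bool} (h1 : ∀ x s, M.ComputesIn s (strPair x []) (strPair [] []) →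
      x.head? ≠ some (χ 1))
    (hχ : ∀ F : ℕ → ℕ → List ℕ, Computable₂ F → (∀ e k, (F e k).length < 2 ^ 2 ^ k) →
      ∃ e, ∀ k n, 2 ^ (e + k + 2) ≤ n → strNum (block e k (initialSegment χ n)) ∉ F e k)
    {t : ℕ → ℕ} (ht : Computable t) : ∃ a : ℕ, ∀ n : ℕ, 1 ≤ n → ∀ K : ℕ,
      M.timedCost t (initialSegment χ n) [] ≤ K → n < 2 ^ a * K := by
  obtain ⟨D, hD, hDM⟩ := hM.exists_primrec_decoder
  let F : ℕ → ℕ → List ℕ := fun e k => (List.range (2 ^ 2 ^ k - 1)).map fun s =>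
    strNum (block e k (D (s.unpair.1, s.unpair.2, t s.unpair.1)))
  have hF : Computable₂ F := by
    have h1 : Computable fun s : ℕ => s.unpair.1 := Computable.fst.comp Computable.unpair
    have h2 : Computable fun s : ℕ => s.unpair.2 := Computable.snd.comp Computable.unpair
    exact computable_block_list (hD.to_comp.comp (h1.pair (h2.pair (ht.comp h1))))
  obtain ⟨e, he⟩ := hχ F hF fun e k => by
    have := Nat.two_pow_pos (2 ^ k)
    simp only [F, List.length_map, List.length_range]
    omega
  -- With log n = 2e + 8 + r, the block number k = e + 6 + r satisfies e + k + 2 = log n, so block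
  -- (e, k) lies within the first n positions.
  refine ⟨2 * e + 8, fun n hn K hK => ?_⟩
  obtain ⟨p, q, s, hs, h, hpq⟩ := (M.timedCost_le_iff t _ _ K).1 hK
  have hlen : (initialSegment χ n).length = n := by simp [initialSegment]
  -- Cost zero means p = q = ε, which `h1` excludes through the first bit.
  have hK : 1 ≤ K := by
    by_contra hK
    obtain rfl := List.length_eq_zero_iff.1 (show p.length = 0 by omega)
    obtain rfl := List.length_eq_zero_iff.1 (show q.length = 0 by omega)
    refine h1 _ _ h ?_
    obtain ⟨m, rfl⟩ : ∃ m, n = m + 1 := ⟨n - 1, by omega⟩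
    simp [initialSegment, List.range_succ_eq_map]
  by_contra hcon
  push Not at hcon
  have hl1 : 2 ^ Nat.log 2 n ≤ n := Nat.pow_log_le_self 2 (by omega)
  have hl2 : n < 2 ^ (Nat.log 2 n + 1) := Nat.lt_pow_succ_log_self (by simp) n
  have hl3 : 2 * e + 8 ≤ Nat.log 2 n :=
    Nat.le_log_of_pow_le (by simp) ((Nat.le_mul_of_pos_right _ hK).trans hcon)
  obtain ⟨r, hr⟩ : ∃ r, Nat.log 2 n = 2 * e + 8 + r := ⟨_, (Nat.add_sub_of_le hl3).symm⟩
  rw [hr] at hl1 hl2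
  -- the number of the block is `e + 6 + r`
  have hKr : K < 2 ^ (r + 1) := by
    have : 2 ^ (2 * e + 8) * K < 2 ^ (2 * e + 8) * 2 ^ (r + 1) := by
      rw [← pow_add]
      exact hcon.trans_lt hl2
    exact Nat.lt_of_mul_lt_mul_left this
  have hpow : 2 * e + 9 + r < 2 ^ (e + 5 + r) := by
    have h1 := (e + r).lt_two_pow_self
    have h2 : 2 ^ (e + 5 + r) = 32 * 2 ^ (e + r) := by ring
    omega
  -- N is the square root of 2 ^ 2 ^ k. Bounding n and the number of q below N puts their pair
  -- within the range of the list, and the block of χ becomes one of its entries.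
  set N := 2 ^ 2 ^ (e + 5 + r) with hN
  have hNn : n + 1 < N := by
    have : 2 ^ (2 * e + 8 + r + 1) < N := Nat.pow_lt_pow_right (by simp) (by omega)
    omega
  have hq : strNum q + 1 < N := by
    refine (strNum_lt q).trans_le (Nat.pow_le_pow_right (by simp) ?_)
    have : 2 ^ (r + 1) ≤ 2 ^ (e + 5 + r) := Nat.pow_le_pow_right (by simp) (by omega)
    omega
  have hpair : Nat.pair n (strNum q) < 2 ^ 2 ^ (e + 6 + r) - 1 := by
    have h1 := Nat.pair_lt_max_add_one_sq n (strNum q)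
    have h2 : max n (strNum q) + 1 ≤ N - 1 := by omega
    have h3 : 2 ^ 2 ^ (e + 6 + r) = N ^ 2 := by
      rw [hN, ← pow_mul]
      ring
    have h4 : (max n (strNum q) + 1) ^ 2 ≤ (N - 1) ^ 2 := Nat.pow_le_pow_left h2 2
    have h5 : (N - 1) ^ 2 ≤ N ^ 2 - 1 := by
      obtain ⟨m, hm⟩ : ∃ m, N = m + 1 := ⟨N - 1, by omega⟩
      rw [hm, Nat.add_sub_cancel]
      have : (m + 1) ^ 2 = m ^ 2 + 2 * m + 1 := by ring
      omega
    rw [h3]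
    omega
  refine he (e + 6 + r) n (by rw [show e + (e + 6 + r) + 2 = 2 * e + 8 + r by ring]; exact hl1) ?_
  refine List.mem_map.2 ⟨Nat.pair n (strNum q), List.mem_range.2 hpair, ?_⟩
  have hp : p.length ≤ n := by
    have : K ≤ 2 ^ (2 * e + 8) * K := Nat.le_mul_of_pos_left _ (by positivity)
    omega
  have := hDM _ p q s (t n) h (by rwa [hlen] at hs) (by rwa [hlen])
  rw [hlen] at this
  simp only [Nat.unpair_pair, this]

end TuringMachine

/-! ## The upper bound -/

/-- The number of ones in a string. -/
def ones (x : List Bool) : ℕ := x.foldl (fun n b => n + b.toNat) 0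

theorem ones_append (x : List Bool) (b : Bool) : ones (x ++ [b]) = ones x + b.toNat := by
  simp [ones]

theorem ones_le_length (x : List Bool) : ones x ≤ x.length := by
  induction x using List.reverseRecOn with
  | nil => simp [ones]
  | append_singleton x b ih =>
    have := b.toNat_le
    rw [ones_append, List.length_append, List.length_singleton]
    omega

theorem primrec_ones : Primrec ones :=
  Primrec.list_foldl .id (.const 0) (Primrec.nat_add.comp (Primrec.fst.comp .snd)
    ((Primrec.dom_finite Bool.toNat).comp (Primrec.snd.comp .snd))).to₂

theorem ones_range_map_le {f g : ℕ → Bool} (h : ∀ i, f i = true → g i = true) (n : ℕ) :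
    ones ((List.range n).map f) ≤ ones ((List.range n).map g) := by
  induction n with
  | zero => rfl
  | succ n ih =>
    have : (f n).toNat ≤ (g n).toNat := by
      have := h n
      cases hf : f n <;> simp_all
    simp only [List.range_succ, List.map_append, List.map_cons, List.map_nil, ones_append]
    omega

/-- Since f lies below g pointwise, a single disagreement would make the counts differ. For stages
of an enumeration, the right number of ones thus certifies that the stage is final on the first n
places. -/
theorem range_map_eq_of_ones_eq {f g : ℕ → Bool} (h : ∀ i, f i = true → g i = true) {n : ℕ}
    (hn : ones ((List.range n).map f) = ones ((List.range n).map g)) :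
    (List.range n).map f = (List.range n).map g := by
  induction n with
  | zero => rfl
  | succ n ih =>
    have h1 := ones_range_map_le h n
    simp only [List.range_succ, List.map_append, List.map_cons, List.map_nil, ones_append] at hn ⊢
    have h2 : f n = g n := by
      have := h n
      cases hf : f n <;> cases hg : g n <;> simp_all
    rw [h2, ih (by rw [h2] at hn; omega)]

open Nat.Partrec (Code)

/-- Initial segments of an r.e. sequence can be erased at logarithmic cost. -/
theorem IsRESequence.exists_eraser {χ : ℕ → Bool} (hχ : IsRESequence χ) :
    ∃ R : TuringMachine, R.IsReversible ∧ ∀ n, ∃ q s,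
      R.ComputesIn s (strPair (initialSegment χ n) []) (strPair [] q) ∧
        2 ^ q.length ≤ (n + 1) ^ 2 := by
  obtain ⟨A, hA, hAχ⟩ := hχ
  obtain ⟨c, hc⟩ := Code.exists_code.1 (Partrec.nat_iff.1
    (Partrec.map hA (Computable.const 0).to₂))
  let st : ℕ → ℕ → Bool := fun s i => (Code.evaln s c (i + 1)).isSome
  have hst : ∀ i, χ (i + 1) = true ↔ ∃ s, st s i = true := by
    intro i
    have : i + 1 ∈ A ↔ (c.eval (i + 1)).Dom := by
      rw [hc]
      simp [Part.assert]
    rw [hAχ _ (by omega), this, Part.dom_iff_mem]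
    simp only [Code.evaln_complete, st, Option.isSome_iff_exists, Option.mem_def]
    exact exists_comm
  have hst_mono : ∀ {s s' i}, s ≤ s' → st s i = true → st s' i = true := by
    intro s s' i hs h
    obtain ⟨a, ha⟩ := Option.isSome_iff_exists.1 h
    exact Option.isSome_iff_exists.2 ⟨a, Code.evaln_mono hs ha⟩
  have hstage : ∀ n, ∃ s, (List.range n).map (st s) = initialSegment χ n := by
    intro n
    have : ∃ s, ∀ i < n, χ (i + 1) = true → st s i = true := by
      induction n with
      | zero => exact ⟨0, by simp⟩
      | succ n ih =>
        obtain ⟨s, hs⟩ := ih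
        obtain ⟨s', hs'⟩ : ∃ s', χ (n + 1) = true → st s' n = true := by
          by_cases h : χ (n + 1) = true
          · obtain ⟨s', h'⟩ := (hst n).1 h
            exact ⟨s', fun _ => h'⟩
          · exact ⟨0, fun h' => absurd h' h⟩
        refine ⟨max s s', fun i hi h => ?_⟩
        rcases Nat.lt_succ_iff_lt_or_eq.1 hi with hi | rfl
        · exact hst_mono (le_max_left _ _) (hs i hi h)
        · exact hst_mono (le_max_right _ _) (hs' h)
    obtain ⟨s, hs⟩ := this
    refine ⟨s, List.map_congr_left fun i hi => ?_⟩
    rw [List.mem_range] at hi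
    exact Bool.eq_iff_iff.2 ⟨fun h => (hst i).2 ⟨s, h⟩, hs i hi⟩
  -- The eraser replaces x by the pair of its length and its number of ones; `g` inverts this on
  -- initial segments of χ by waiting for a stage with enough ones.
  let f : ℕ → ℕ := fun u => Nat.pair 0 (Nat.pair (numStr u.unpair.1).length
    (ones (numStr u.unpair.1)))
  let g : ℕ →. ℕ := fun v => (Nat.rfind fun s => Part.some (decide
    (ones ((List.range v.unpair.2.unpair.1).map (st s)) = v.unpair.2.unpair.2))).map fun s =>
      Nat.pair (strNum ((List.range v.unpair.2.unpair.1).map (st s))) 0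
  have hf : Primrec f := by
    have h : Primrec fun u : ℕ => numStr u.unpair.1 :=
      primrec_numStr.comp (Primrec.fst.comp Primrec.unpair)
    exact Primrec₂.natPair.comp (.const 0) (Primrec₂.natPair.comp (Primrec.list_length.comp h)
      (primrec_ones.comp h))
  have hg : Partrec g := by
    have hu : Primrec fun p : ℕ × ℕ => p.1.unpair.2.unpair :=
      Primrec.unpair.comp (Primrec.snd.comp (Primrec.unpair.comp .fst))
    have hl : Primrec fun p : ℕ × ℕ => (List.range p.1.unpair.2.unpair.1).map (st p.2) := by
      have : Primrec₂ fun (p : ℕ × ℕ) (i : ℕ) => st p.2 i :=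
        Primrec.option_isSome.comp (Code.primrec_evaln.comp (.pair (.pair
          (Primrec.snd.comp .fst) (.const c)) (Primrec.succ.comp .snd)))
      exact Primrec.list_map (Primrec.list_range.comp (Primrec.fst.comp hu)) this
    have h1 : Partrec₂ fun v s : ℕ => (Part.some (decide (ones
        ((List.range v.unpair.2.unpair.1).map (st s)) = v.unpair.2.unpair.2)) : Part Bool) :=
      (PrimrecPred.decide (Primrec.eq.comp (primrec_ones.comp hl)
        (Primrec.snd.comp hu))).to_comp.partrec
    have h2 : Computable₂ fun v s : ℕ =>
        Nat.pair (strNum ((List.range v.unpair.2.unpair.1).map (st s))) 0 :=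
      (Primrec₂.natPair.comp (primrec_strNum.comp hl) (.const 0)).to_comp
    exact Partrec.map (Partrec.rfind h1) h2
  obtain ⟨R, hR, hRc⟩ := RevMachine.exists_reversible_of_partrec hf.to_comp.partrec hg
  refine ⟨R, hR, fun n => ?_⟩
  have hlen : (initialSegment χ n).length = n := by simp [initialSegment]
  set m := ones (initialSegment χ n) with hm
  refine ⟨numStr (Nat.pair n m), ?_⟩
  have hv : strNum (strPair [] (numStr (Nat.pair n m))) = Nat.pair 0 (Nat.pair n m) := by
    rw [strNum_strPair, strNum_numStr]
    rfl
  have hu : strNum (strPair (initialSegment χ n) []) =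
      Nat.pair (strNum (initialSegment χ n)) 0 := strNum_strPair _ _
  obtain ⟨s, hs⟩ := hRc (strPair (initialSegment χ n) []) (strPair [] (numStr (Nat.pair n m)))
    (by
      rw [hv, hu]
      simp [f, numStr_strNum, hlen, hm])
    (by
      rw [hv, hu]
      have hdom : (Nat.rfind fun s => Part.some (decide
          (ones ((List.range n).map (st s)) = m))).Dom := by
        obtain ⟨s, hs⟩ := hstage n
        exact Nat.rfind_dom.2 ⟨s, by simp [hs, hm], fun _ => trivial⟩
      obtain ⟨s, hs⟩ := Part.dom_iff_mem.1 hdom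
      simp only [g, Nat.unpair_pair]
      refine (Part.mem_map_iff _).2 ⟨s, hs, ?_⟩
      have h1 := Nat.rfind_spec hs
      simp only [Part.mem_some_iff, eq_comm (a := true), decide_eq_true_eq] at h1
      have h2 : (List.range n).map (st s) = initialSegment χ n :=
        range_map_eq_of_ones_eq (fun i h => (hst i).2 ⟨s, h⟩) (h1.trans hm)
      rw [h2])
  refine ⟨s, hs, ?_⟩
  rw [length_numStr]
  refine (Nat.pow_log_le_self 2 (by omega)).trans ?_
  have h1 := Nat.pair_lt_max_add_one_sq n m
  have h2 : m ≤ n := (ones_le_length _).trans_eq hlen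
  rwa [max_eq_left h2] at h1

end

/-! ## The extreme trade-off -/

section

open TuringMachine
open Nat.Partrec (Code)

theorem strPair_left_injective {x y p q : List Bool} (h : strPair x p = strPair y q) : x = y := by
  have h1 := congrArg strNum h
  rw [strNum_strPair, strNum_strPair, Nat.pair_eq_pair] at h1
  rw [← numStr_strNum x, h1.1, numStr_strNum]

/-- Every function is below one that eventually exceeds all computable functions. -/
theorem exists_dominating (s : ℕ → ℕ) : ∃ T : ℕ → ℕ, (∀ n, s n ≤ T n) ∧
    ∀ t : ℕ → ℕ, Computable t → ∀ᶠ n in Filter.atTop, t n < T n := by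
  classical
  let g : ℕ → ℕ → ℕ := fun e n =>
    if h : ((Denumerable.ofNat Code e).eval n).Dom then ((Denumerable.ofNat Code e).eval n).get h
    else 0
  -- Each total recursive function has some code e, and its value is a summand for all n ≥ e;
  -- undefined values count as 0.
  refine ⟨fun n => s n + 1 + ∑ e ∈ Finset.range (n + 1), g e n, fun n => ?_,
    fun t ht => ?_⟩
  · change s n ≤ s n + 1 + _
    omega
  obtain ⟨c, hc⟩ := Code.exists_code.1 (Partrec.nat_iff.1 ht)
  refine Filter.eventually_atTop.2 ⟨Encodable.encode c, fun n hn => ?_⟩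
  have h1 : g (Encodable.encode c) n = t n := by
    simp [g, hc]
  have h2 := Finset.single_le_sum (f := fun e => g e n) (fun _ _ => Nat.zero_le _)
    (Finset.mem_range.2 (Nat.lt_add_one_of_le hn))
  simp only [h1] at h2
  change t n < s n + 1 + _
  exact h2.trans_lt (by omega)

/-- Reversibility allows at most one x to be erased at cost zero; the opposite of its first bit is
taken. -/
theorem TuringMachine.IsReversible.exists_ne_head {M : TuringMachine} (hM : M.IsReversible) :
    ∃ b : Bool, ∀ x s, M.ComputesIn s (strPair x []) (strPair [] []) → x.head? ≠ some b := by
  by_cases h : ∃ x s, M.ComputesIn s (strPair x []) (strPair [] [])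
  · obtain ⟨x, s, h⟩ := h
    refine ⟨!(x.headD false), fun y s' h' => ?_⟩
    obtain rfl := strPair_left_injective (hM.input_unique h h')
    cases x <;> simp
  · exact ⟨false, fun x s h' => absurd ⟨x, s, h'⟩ h⟩

/-- A time bound that allows a universal reversible machine to erase the initial segments of an
r.e. sequence at logarithmic cost. -/
theorem TuringMachine.IsUniversalReversible.exists_timedCost_le {M : TuringMachine}
    (hM : M.IsUniversalReversible) {χ : ℕ → Bool} (hχ : IsRESequence χ) :
    ∃ (T : ℕ → ℕ) (C : ℕ), (∀ t : ℕ → ℕ, Computable t → ∀ᶠ n in Filter.atTop, t n < T n) ∧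
      ∀ n, ∃ k : ℕ, M.timedCost T (initialSegment χ n) [] = k ∧ 2 ^ k ≤ (2 ^ C * (n + 1)) ^ 2 := by
  obtain ⟨R, hR, hRc⟩ := hχ.exists_eraser
  obtain ⟨C, hC⟩ := hM.2 R hR
  have key : ∀ n, ∃ s p q, M.ComputesIn s (strPair (initialSegment χ n) p) (strPair [] q) ∧
      2 ^ (p.length + q.length) ≤ 2 ^ C * (n + 1) ^ 2 := by
    intro n
    obtain ⟨q, s, h, hq⟩ := hRc n
    have h1 : R.cost (initialSegment χ n) [] ≤ (q.length : ℕ) :=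
      (R.cost_le_iff _ _ _).2 ⟨[], q, s, h, by simp⟩
    have h2 : M.cost (initialSegment χ n) [] ≤ (q.length + C : ℕ) := by
      rw [Nat.cast_add]
      exact (hC _ _).trans (add_le_add_left h1 _)
    obtain ⟨p', q', s', h', hpq⟩ := (M.cost_le_iff _ _ _).1 h2
    refine ⟨s', p', q', h', (Nat.pow_le_pow_right (n := 2) (by simp) hpq).trans ?_⟩
    rw [pow_add, mul_comm]
    exact Nat.mul_le_mul_left _ hq
  -- The running times s need not be computable; T only has to lie above them.
  choose s p q hs hpq using key
  obtain ⟨T, hsT, hT⟩ := exists_dominating s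
  refine ⟨T, C, hT, fun n => ?_⟩
  have hle : M.timedCost T (initialSegment χ n) [] ≤ ((p n).length + (q n).length : ℕ) :=
    (M.timedCost_le_iff _ _ _ _).2 ⟨p n, q n, s n, by simpa [initialSegment] using hsT n,
      hs n, le_rfl⟩
  obtain ⟨k, hk⟩ := ENat.ne_top_iff_exists.1 (ne_top_of_le_ne_top (ENat.natCast_ne_top _) hle)
  refine ⟨k, hk.symm, ?_⟩
  rw [← hk, Nat.cast_le] at hle
  refine (Nat.pow_le_pow_right (by simp) hle).trans ((hpq n).trans ?_)
  -- Weakening 2 ^ C to its square makes the bound a perfect square, whose root is taken later.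
  rw [mul_pow]
  exact Nat.mul_le_mul_right _ (Nat.le_self_pow (by simp) _)

theorem two_rpow_half_le {k m : ℕ} (h : 2 ^ k ≤ m ^ 2) : (2 : ℝ) ^ ((k : ℝ) / 2) ≤ m := by
  refine _root_.le_of_sq_le_sq ?_ (Nat.cast_nonneg m)
  rw [← Real.rpow_natCast, ← Real.rpow_mul (by simp), Nat.cast_ofNat, div_mul_cancel₀ _ (by simp),
    Real.rpow_natCast]
  exact_mod_cast h

end

theorem mainTheorem5 :
    (∃ UR : TuringMachine, UR.IsUniversalReversible) ∧
    ∀ UR : TuringMachine, UR.IsUniversalReversible →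
      ∃ (χ : ℕ → Bool) (T : ℕ → ℕ), IsRESequence χ ∧
        (∀ t : ℕ → ℕ, Computable t → ∀ᶠ n in Filter.atTop, t n < T n) ∧
        ∀ t : ℕ → ℕ, Computable t →
          ∃ c : ℝ, 0 < c ∧ ∀ n : ℕ, 1 ≤ n →
            UR.timedCost T (initialSegment χ n) [] ≠ ⊤ ∧
            ENNReal.ofReal
                (c * (2 : ℝ) ^ (((UR.timedCost T (initialSegment χ n) []).toNat : ℝ) / 2)) <
              ((UR.timedCost t (initialSegment χ n) [] : ℕ∞) : ENNReal) := by
  refine ⟨TuringMachine.exists_isUniversalReversible, fun UR hUR => ?_⟩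
  obtain ⟨b, hb⟩ := hUR.1.exists_ne_head
  obtain ⟨χ, hχ, rfl, hav⟩ := exists_isRESequence_avoiding b
  obtain ⟨T, C, hT, hTC⟩ := hUR.exists_timedCost_le hχ
  refine ⟨χ, T, hχ, hT, fun t ht => ?_⟩
  obtain ⟨a, ha⟩ := hUR.1.exists_linear_lower_bound hb hav ht
  -- From 2 ^ (k / 2) ≤ 2 ^ C (n + 1) ≤ 2 ^ C · 2n and n < 2 ^ a K; the factor 2 absorbs n + 1 ≤ 2n.
  refine ⟨(2 ^ a * 2 ^ C * 2)⁻¹, by positivity, fun n hn => ?_⟩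
  obtain ⟨k, hk, hkn⟩ := hTC n
  refine ⟨by rw [hk]; exact ENat.natCast_ne_top k, ?_⟩
  rw [hk, ENat.toNat_natCast]
  rcases eq_or_ne (UR.timedCost t (initialSegment χ n) []) ⊤ with htop | htop
  · rw [htop, ENat.toENNReal_top]
    exact ENNReal.ofReal_lt_top
  · obtain ⟨K, hK⟩ := ENat.ne_top_iff_exists.1 htop
    have h1 : (n : ℝ) < 2 ^ a * K := mod_cast ha n hn K hK.ge
    have h2 : (2 : ℝ) ^ ((k : ℝ) / 2) ≤ 2 ^ C * (n + 1) := by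
      exact_mod_cast two_rpow_half_le hkn
    have h3 : (1 : ℝ) ≤ n := mod_cast hn
    rw [← hK, ENat.toENNReal_coe, ENNReal.ofReal_lt_natCast (by rintro rfl; simp at h1; linarith),
      inv_mul_lt_iff₀ (by positivity)]
    have h4 : (2 : ℝ) ^ C * (n + 1) ≤ 2 ^ C * (2 * n) := by gcongr; linarith
    have h5 : (2 : ℝ) ^ C * (2 * n) < 2 ^ C * (2 * (2 ^ a * K)) := by gcongr
    calc _ ≤ _ := h2
      _ ≤ _ := h4
      _ < _ := h5
      _ = _ := by ring
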